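/- **Setting.** Let $(X_t)_{t\in\mathbb Z}$ be an $\mathbb R^d$-valued time series and $\theta$ an $\mathbb R^p$-valued functional of $d$-dimensional distribution functions. Let $F_t$ be the distribution function of $X_t$, $F=F_1$, and let $$\mathcal{IF}(x)=\lim_{\varepsilon\searrow 0}\varepsilon^{-1}\big(\theta((1-\varepsilon)F+\varepsilon\delta_x)-\theta(F)\big)\qquad (x\in\mathbb R^d)$$ be the influence function of $\theta$ at $F$, assumed to exist, where $\delta_x(z)=I\{x\le z\}$ (componentwise inequality). For $1\le i\le j$ put $\hat\theta_i^j=\theta(\hat F_i^j)$, where $\hat F_i^j(z)=\frac1{j-i+1}\sum_{t=i}^jI\{X_t\le z\}$, and put $\hat\theta_i^j=0$ for $i>j$. Fix $T>0$ and a non-decreasing function $w:[0,T]\to(0,\infty)$. For $m,k\ge 1$ and $z\le u$ define $$\mathbb V(z,u)=\sum_{j=1}^{z}j^2(z-j)^2(\hat\theta_1^j-\hat\theta_{j+1}^z)(\hat\theta_1^j-\hat\theta_{j+1}^z)^\top+\sum_{j=z+1}^{u}(u-j)^2(j-z)^2(\hat\theta_{z+1}^j-\hat\theta_{j+1}^u)(\hat\theta_{z+1}^j-\hat\theta_{j+1}^u)^\top,$$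 $$\hat D^{\rm SN}_m(k)=m\max_{j=0}^{k-1}(m+j)^2(k-j)^2(\hat\theta_1^{m+j}-\hat\theta_{m+j+1}^{m+k})^\top\,\mathbb V(m+j,m+k)^{-1}\,(\hat\theta_1^{m+j}-\hat\theta_{m+j+1}^{m+k})$$ (if $\mathbb V(m+j,m+k)$ is singular, its inverse is read as $0$). **Theorem.** Suppose that the null hypothesis $\theta(F_1)=\theta(F_2)=\cdots$ holds and that: 1. $(X_t)$ is strictly stationary, $\mathcal{IF}(X_t)$ is square integrable, $\mathbb E[\mathcal{IF}(X_1)]=0$, the series $\Sigma_F=\sum_{t\in\mathbb Z}\operatorname{Cov}(\mathcal{IF}(X_0),\mathcal{IF}(X_t))$ converges, $\Sigma_F$ is positive definite, and, as $m\to\infty$, $m^{-1/2}\sum_{t=1}^{\lfloor ms\rfloor}\mathcal{IF}(X_t)$ converges weakly to $\Sigma_F^{1/2}W(s)$ in $\ell^\infty([0,T+1],\mathbb R^p)$, where $W$ is a $p$-dimensional standard Brownian motion; 2. the remainders $R_{i,j}=\hat\theta_i^j-\theta(F)-\frac1{j-i+1}\sum_{t=i}^j\mathcal{IF}(X_t)$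 satisfy $\max_{1\le i\le j\le n}(j-i+1)|R_{i,j}|=o_{\mathbb P}(n^{1/2})$ as $n\to\infty$. Then, as $m\to\infty$, $$\max_{1\le k\le \lfloor Tm\rfloor}\frac{\hat D^{\rm SN}_m(k)}{w(k/m)}\ \overset{\mathcal D}{\Longrightarrow}\ \sup_{t\in[1,T+1]}\ \sup_{s\in[1,t]}\frac{|\tilde B(s,t)|}{w(t-1)},$$ where $B(s,t)=tW(s)-sW(t)$, $\tilde B(s,t)=B(s,t)^\top\big(N_1(s)+N_2(s,t)\big)^{-1}B(s,t)$ and $$N_1(s)=\int_0^sB(r,s)B(r,s)^\top dr,$$ $$N_2(s,t)=\int_s^t\big(B(r,t)+B(s,r)-B(s,t)\big)\big(B(r,t)+B(s,r)-B(s,t)\big)^\top dr.$$ -/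

import Mathlib

open MeasureTheory ProbabilityTheory Filter Topology Set
open scoped NNReal ENNReal Matrix MatrixOrder

namespace SeqMonitor

noncomputable section

/-- Vectors in `ℝⁿ` with the Euclidean norm. -/
abbrev Vec (n : ℕ) : Type := EuclideanSpace ℝ (Fin n)

/-! ### The space `ℓ^∞(V, E)` of bounded functions with the supremum norm -/

/-- The space of bounded functions `V → E` with the supremum norm. -/
abbrev EllInfty (V : Type) (E : Type) [NormedAddCommGroup E] : Type :=
  lp (fun _ : V => E) ∞

instance (V E : Type) [NormedAddCommGroup E] : MeasurableSpace (EllInfty V E) := borel _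

instance (V E : Type) [NormedAddCommGroup E] : BorelSpace (EllInfty V E) := ⟨rfl⟩

open Classical in
/-- A bounded function as an element of `ℓ^∞(V, E)`; unbounded functions are sent to `0`
(for the processes below this happens at most on a null set). -/
def toEllInfty {V E : Type} [NormedAddCommGroup E] (f : V → E) : EllInfty V E :=
  if h : Memℓp (E := fun _ : V => E) f ∞ then ⟨f, h⟩ else 0

/-! ### Distribution functions, functionals, influence functions -/

section Functionals

variable {Ω : Type*} {d p : ℕ}

/-- The distribution function `z ↦ ℙ(Y ≤ z)` of a random vector (componentwise order). -/
def distFun [MeasurableSpace Ω] (μ : Measure Ω) (Y : Ω → Vec d) : Vec d → ℝ :=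
  fun z => μ.real {ω | ∀ l, Y ω l ≤ z l}

open Classical in
/-- The distribution function `z ↦ I{x ≤ z}` of the Dirac measure at `x`. -/
def diracDF (x : Vec d) : Vec d → ℝ :=
  fun z => if ∀ l, x l ≤ z l then 1 else 0

/-- The empirical distribution function of `X_i, …, X_j`. -/
def empDF (X : ℤ → Ω → Vec d) (i j : ℕ) (ω : Ω) : Vec d → ℝ :=
  fun z => (1 / ((j : ℝ) - i + 1)) * ∑ t ∈ Finset.Icc i j, diracDF (X t ω) z

/-- The estimator `θ̂_i^j = θ(F̂_i^j)`, with the convention `θ̂_i^j = 0` for `i > j`. -/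
def thetaHat (θ : (Vec d → ℝ) → Vec p) (X : ℤ → Ω → Vec d) (i j : ℕ) (ω : Ω) : Vec p :=
  if i ≤ j then θ (empDF X i j ω) else 0

/-- `IF` is the influence function of the functional `θ` at `F`: for every `x`, the limit
`lim_{ε ↘ 0} (θ((1 - ε) F + ε δ_x) - θ(F)) / ε` exists and equals `IF x`. -/
def IsInfluenceFunction (θ : (Vec d → ℝ) → Vec p) (F : Vec d → ℝ) (IF : Vec d → Vec p) : Prop :=
  ∀ x, Tendsto (fun ε : ℝ => ε⁻¹ • (θ ((1 - ε) • F + ε • diracDF x) - θ F))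
    (𝓝[>] 0) (𝓝 (IF x))

/-- The remainder `R_{i,j} = θ̂_i^j - θ(F) - (j - i + 1)⁻¹ ∑_{t=i}^j IF(X_t)`. -/
def remainder (θ : (Vec d → ℝ) → Vec p) (F : Vec d → ℝ) (IF : Vec d → Vec p)
    (X : ℤ → Ω → Vec d) (i j : ℕ) (ω : Ω) : Vec p :=
  thetaHat θ X i j ω - θ F - (1 / ((j : ℝ) - i + 1)) • ∑ t ∈ Finset.Icc i j, IF (X t ω)

/-- `max_{1 ≤ i ≤ j ≤ n} (j - i + 1) |R_{i,j}|` (a maximum over a finite set). -/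
def maxRemainder (θ : (Vec d → ℝ) → Vec p) (F : Vec d → ℝ) (IF : Vec d → Vec p)
    (X : ℤ → Ω → Vec d) (n : ℕ) (ω : Ω) : ℝ :=
  ⨆ q : {q : ℕ × ℕ // 1 ≤ q.1 ∧ q.1 ≤ q.2 ∧ q.2 ≤ n},
    ((q.1.2 : ℝ) - q.1.1 + 1) * ‖remainder θ F IF X q.1.1 q.1.2 ω‖

/-- The partial sum process `s ↦ m^{-1/2} ∑_{t=1}^{⌊ms⌋} IF(X_t)`, `s ∈ [0, b]`. -/
def partialSum (IF : Vec d → Vec p) (X : ℤ → Ω → Vec d) (b : ℝ) (m : ℕ) (ω : Ω)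
    (s : Icc (0 : ℝ) b) : Vec p :=
  (1 / √(m : ℝ)) • ∑ t ∈ Finset.Icc 1 ⌊(m : ℝ) * (s : ℝ)⌋₊, IF (X t ω)

/-- The paths of the partial sum process are bounded, hence are elements of `ℓ^∞`. -/
theorem toEllInfty_partialSum (IF : Vec d → Vec p) (X : ℤ → Ω → Vec d) (b : ℝ) (m : ℕ) (ω : Ω)
    (s : Icc (0 : ℝ) b) :
    (toEllInfty (partialSum IF X b m ω) : Icc (0 : ℝ) b → Vec p) s = partialSum IF X b m ω s := by
  have h : Memℓp (E := fun _ : Icc (0 : ℝ) b => Vec p) (partialSum IF X b m ω) ∞ := by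
    refine memℓp_infty ⟨|1 / √(m : ℝ)| * ∑ t ∈ Finset.Icc 1 ⌊(m : ℝ) * b⌋₊, ‖IF (X t ω)‖, ?_⟩
    rintro _ ⟨u, rfl⟩
    simp only [partialSum, norm_smul, Real.norm_eq_abs]
    refine mul_le_mul_of_nonneg_left ((norm_sum_le _ _).trans ?_) (abs_nonneg _)
    refine Finset.sum_le_sum_of_subset_of_nonneg ?_ fun _ _ _ => norm_nonneg _
    refine Finset.Icc_subset_Icc le_rfl (Nat.floor_mono ?_)
    exact mul_le_mul_of_nonneg_left u.2.2 (Nat.cast_nonneg m)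
  simp [toEllInfty, h]

/-- Strict stationarity: the law of the whole series is invariant under time shifts. -/
def IsStrictlyStationary [MeasurableSpace Ω] (μ : Measure Ω) (X : ℤ → Ω → Vec d) : Prop :=
  ∀ h : ℤ, μ.map (fun ω (t : ℤ) => X (t + h) ω) = μ.map (fun ω (t : ℤ) => X t ω)

/-- `S = ∑_{t ∈ ℤ} Cov(Y_0, Y_t)`, as the limit of the symmetric partial sums. -/
def IsLongRunVariance [MeasurableSpace Ω] (μ : Measure Ω) (Y : ℤ → Ω → Vec p)
    (S : Matrix (Fin p) (Fin p) ℝ) : Prop :=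
  ∀ a b, Tendsto
    (fun n : ℕ => ∑ t ∈ Finset.Icc (-(n : ℤ)) n, cov[fun ω => Y 0 ω a, fun ω => Y t ω b; μ])
    atTop (𝓝 (S a b))

end Functionals

/-! ### Brownian motion and the limiting processes -/

/-- `p`-dimensional standard Brownian motion: the coordinates are independent real standard
Brownian motions. -/
structure IsStdBrownianMotion {Ω' : Type*} [MeasurableSpace Ω'] {p : ℕ}
    (W : ℝ≥0 → Ω' → Vec p) (P : Measure Ω') : Prop where
  measurable : ∀ t, Measurable (W t)
  coord : ∀ a, IsBrownianReal (fun t ω => W t ω a) P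
  indep : iIndepFun (fun (a : Fin p) (ω : Ω') (t : ℝ≥0) => W t ω a) P

/-- The path `s ↦ W(s)` for `s ≥ 0`, as a function of a real variable. -/
def path {Ω' : Type*} {p : ℕ} (W : ℝ≥0 → Ω' → Vec p) (ω : Ω') : ℝ → Vec p :=
  fun s => W s.toNNReal ω

section Limit

variable {p : ℕ}

/-- `B(s,t) = t W(s) - s W(t)`. -/
def bridge (x : ℝ → Vec p) (s t : ℝ) : Vec p := t • x s - s • x t

/-- `N₁(s) = ∫₀ˢ B(r,s) B(r,s)ᵀ dr`. -/
def N1 (x : ℝ → Vec p) (s : ℝ) : Matrix (Fin p) (Fin p) ℝ :=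
  Matrix.of fun a b => ∫ r in (0 : ℝ)..s, bridge x r s a * bridge x r s b

/-- `N₂(s,t) = ∫ₛᵗ (B(r,t) + B(s,r) - B(s,t)) (B(r,t) + B(s,r) - B(s,t))ᵀ dr`. -/
def N2 (x : ℝ → Vec p) (s t : ℝ) : Matrix (Fin p) (Fin p) ℝ :=
  Matrix.of fun a b => ∫ r in s..t,
    (bridge x r t + bridge x s r - bridge x s t) a *
      (bridge x r t + bridge x s r - bridge x s t) b

/-- The quadratic form `vᵀ A v`. -/
def quadForm (A : Matrix (Fin p) (Fin p) ℝ) (v : Vec p) : ℝ :=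
  v.ofLp ⬝ᵥ (A *ᵥ v.ofLp)

/-- `B̃(s,t) = B(s,t)ᵀ (N₁(s) + N₂(s,t))⁻¹ B(s,t)`. -/
def bridgeSN (x : ℝ → Vec p) (s t : ℝ) : ℝ :=
  quadForm (N1 x s + N2 x s t)⁻¹ (bridge x s t)

/-- `sup_{t ∈ [1,T+1]} sup_{s ∈ [1,t]} |B̃(s,t)| / w(t-1)`. -/
def limitSN (T : ℝ) (w : ℝ → ℝ) (x : ℝ → Vec p) : ℝ :=
  ⨆ t : Icc (1 : ℝ) (T + 1), ⨆ s : Icc (1 : ℝ) (t : ℝ),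
    |bridgeSN x (s : ℝ) (t : ℝ)| / w ((t : ℝ) - 1)

end Limit

/-! ### The self-normalized detector -/

section Detector

variable {Ω : Type*} {d p : ℕ}

/-- The outer product `v vᵀ`. -/
def outer (v : Vec p) : Matrix (Fin p) (Fin p) ℝ := Matrix.vecMulVec v.ofLp v.ofLp

/-- The self-normalizing matrix `𝕍(z,u)`. -/
def snMatrix (θ : (Vec d → ℝ) → Vec p) (X : ℤ → Ω → Vec d) (z u : ℕ) (ω : Ω) :
    Matrix (Fin p) (Fin p) ℝ :=
  ∑ j ∈ Finset.Icc 1 z, ((j : ℝ) ^ 2 * ((z : ℝ) - j) ^ 2) •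
      outer (thetaHat θ X 1 j ω - thetaHat θ X (j + 1) z ω) +
  ∑ j ∈ Finset.Icc (z + 1) u, (((u : ℝ) - j) ^ 2 * ((j : ℝ) - z) ^ 2) •
      outer (thetaHat θ X (z + 1) j ω - thetaHat θ X (j + 1) u ω)

/-- The self-normalized detector `D̂^SN_m(k)`, a maximum over `j = 0, …, k-1`. -/
def detectorSN (θ : (Vec d → ℝ) → Vec p) (X : ℤ → Ω → Vec d) (m k : ℕ) (ω : Ω) : ℝ :=
  (m : ℝ) * ⨆ j : Fin k, (((m : ℝ) + j) ^ 2 * ((k : ℝ) - j) ^ 2) *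
    quadForm (snMatrix θ X (m + j) (m + k) ω)⁻¹
      (thetaHat θ X 1 (m + j) ω - thetaHat θ X (m + j + 1) (m + k) ω)

/-- `max_{1 ≤ k ≤ ⌊Tm⌋} D̂^SN_m(k) / w(k/m)`. -/
def maxDetectorSN (θ : (Vec d → ℝ) → Vec p) (X : ℤ → Ω → Vec d) (T : ℝ) (w : ℝ → ℝ)
    (m : ℕ) (ω : Ω) : ℝ :=
  ⨆ k : Finset.Icc 1 ⌊T * (m : ℝ)⌋₊, detectorSN θ X m k ω / w (((k : ℕ) : ℝ) / m)

end Detector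

/-! ### The standing assumptions -/

section Assumptions

variable {Ω Ω' : Type*} [MeasurableSpace Ω] [MeasurableSpace Ω'] {d p : ℕ}

/-- Stationarity, centring, existence of the long-run variance `S = Σ_F` and the functional central
limit theorem `m^{-1/2} ∑_{t ≤ ⌊ms⌋} IF(X_t) ⇒ √Σ_F W(s)` in `ℓ^∞([0,T+1], ℝᵖ)`. -/
structure InvarianceAssumption (μ : Measure Ω) [IsProbabilityMeasure μ]
    (P : Measure Ω') [IsProbabilityMeasure P] (T : ℝ)
    (X : ℤ → Ω → Vec d) (IF : Vec d → Vec p) (S : Matrix (Fin p) (Fin p) ℝ)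
    (W : ℝ≥0 → Ω' → Vec p) : Prop where
  stationary : IsStrictlyStationary μ X
  memLp : ∀ t, MemLp (fun ω => IF (X t ω)) 2 μ
  centred : ∫ ω, IF (X 1 ω) ∂μ = 0
  longRun : IsLongRunVariance μ (fun t ω => IF (X t ω)) S
  fclt : TendstoInDistribution
    (fun (m : ℕ) ω => toEllInfty (partialSum IF X (T + 1) m ω)) atTop
    (fun ω => toEllInfty (fun s : Icc (0 : ℝ) (T + 1) =>
      (WithLp.toLp 2 (CFC.sqrt S *ᵥ (path W ω (s : ℝ)).ofLp) : Vec p)))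
    (fun _ => μ) P

/-- The remainders satisfy `max_{1 ≤ i ≤ j ≤ n} (j - i + 1) |R_{i,j}| = o_ℙ(n^{1/2})`. -/
def RemainderAssumption (μ : Measure Ω) (θ : (Vec d → ℝ) → Vec p) (F : Vec d → ℝ)
    (IF : Vec d → Vec p) (X : ℤ → Ω → Vec d) : Prop :=
  TendstoInMeasure μ (fun (n : ℕ) ω => maxRemainder θ F IF X n ω / √(n : ℝ)) atTop (fun _ => 0)

end Assumptions

end

end SeqMonitor

/-! The detector is a ratio in which both unknowns cancel. Centring at `θ F` disappears from every
difference of estimators, and a self-normalized form vᵀ V⁻¹ v does not change when v and V become A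
v and A V Aᵀ with A invertible. So all estimators may be multiplied by the inverse square root of
the long-run variance (`maxContrastSN_mulVec`), and the partial sums may be compared with W itself.

By the expansion into influence functions plus small remainders, (j - i) times a centred block
estimator is √m times an increment of the partial sum process, up to a negligible error
(`isPathApprox_inv_mulVec`). What remains is deterministic. If the estimators follow a fixed
continuous path x in this sense, the contrasts divided by m^(3/2) are close to bridges of x, the
self-normalizer divided by m⁴ is a Riemann sum for N₁ + N₂, and the weighted maximum is close to the
supremum over the triangle 1 ≤ s ≤ t ≤ T + 1 (`exists_abs_maxContrastSN_sub_lt`).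

Matrix inversion demands that N₁(s) + N₂(s,t) be nonsingular throughout the triangle. N₁(s) alone is
positive definite unless some nontrivial combination of the coordinates of x is linear on [0, 1];
for Brownian motion the law of large numbers for rescaled increments excludes this almost surely
(`IsStdBrownianMotion.ae_forall_linear_eq_zero`).

The limit path thus only has to be good almost surely. An extended continuous mapping theorem,
`tendstoInDistribution_of_forall_dist_lt`, turns the pathwise estimate into convergence in
distribution and absorbs the remainders. -/

namespace SeqMonitor

/-! ### Convergence in distribution from pathwise estimates -/

/-- An extended continuous mapping theorem: if `Y m ⇒ Y₀`, `r m → 0` in probability and, for almost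
every value of `Y₀`, the variable `D m` is close to `Z` as soon as `Y m` is close to that value and
`r m` is small, then `D m ⇒ Z`. -/
theorem tendstoInDistribution_of_forall_dist_lt {Ω Ω' E : Type*} [MeasurableSpace Ω]
    [MeasurableSpace Ω'] [PseudoMetricSpace E] [MeasurableSpace E] [BorelSpace E]
    {μ : Measure Ω} [IsProbabilityMeasure μ] {P : Measure Ω'} [IsProbabilityMeasure P]
    {Y : ℕ → Ω → E} {Y₀ : Ω' → E}
    (hY : TendstoInDistribution Y atTop Y₀ (fun _ => μ) P)
    {r : ℕ → Ω → ℝ} (hr : TendstoInMeasure μ r atTop (fun _ => 0))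
    {D : ℕ → Ω → ℝ} (hD : ∀ m, AEMeasurable (D m) μ)
    {Z : Ω' → ℝ} (hZ : AEMeasurable Z P)
    (h : ∀ᵐ ω' ∂P, ∀ ε > 0, ∃ δ > 0, ∃ m₀ : ℕ, ∀ m ≥ m₀, ∀ ω,
      dist (Y m ω) (Y₀ ω') < δ → ‖r m ω‖ < δ → |D m ω - Z ω'| < ε) :
    TendstoInDistribution D atTop Z (fun _ => μ) P := by
  refine ⟨hD, hZ, tendsto_of_forall_isClosed_limsup_le' fun K hK => ?_⟩
  simp only [ProbabilityMeasure.coe_mk]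
  rw [Measure.map_apply_of_aemeasurable hZ hK.measurableSet]
  have hmap : ∀ m, μ.map (D m) K = μ (D m ⁻¹' K) := fun m =>
    Measure.map_apply_of_aemeasurable (hD m) hK.measurableSet
  simp_rw [hmap]
  -- Values of `Y m`, m ≥ n, compatible with `D m ∈ K` and a small remainder. These sets need not be
  -- measurable, so the portmanteau inequality is applied to their closures.
  let A : ℕ → Set E := fun n =>
    {y | ∃ m ≥ n, ∃ ω, Y m ω = y ∧ ‖r m ω‖ < 1 / ((n : ℝ) + 1) ∧ D m ω ∈ K}
  let C : ℕ → Set E := fun n => closure (A n)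
  have hC : ∀ n, IsClosed (C n) := fun n => isClosed_closure
  have hanti : Antitone C := by
    intro n n' hn
    refine closure_mono ?_
    rintro y ⟨m, hm, ω, h1, h2, h3⟩
    refine ⟨m, hn.trans hm, ω, h1, h2.trans_le ?_, h3⟩
    gcongr
  have hlim : ∀ n, limsup (fun m => μ (D m ⁻¹' K)) atTop ≤ P.map Y₀ (C n) := by
    intro n
    have h0 : Tendsto (fun m => μ {ω | 1 / ((n : ℝ) + 1) ≤ ‖r m ω‖}) atTop (𝓝 0) := by
      simpa using (tendstoInMeasure_iff_norm.1 hr) (1 / ((n : ℝ) + 1)) (by positivity)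
    have h1 : limsup (fun m => μ.map (Y m) (C n)) atTop ≤ P.map Y₀ (C n) :=
      ProbabilityMeasure.limsup_measure_closed_le_of_tendsto hY.tendsto (hC n)
    refine le_trans ?_ h1
    rw [← ENNReal.limsup_add_of_right_tendsto_zero h0 fun m => μ.map (Y m) (C n)]
    refine limsup_le_limsup ?_
    filter_upwards [eventually_ge_atTop n] with m hm
    rw [Pi.add_apply, Measure.map_apply_of_aemeasurable (hY.forall_aemeasurable m)
      (hC n).measurableSet]
    refine (measure_mono (μ := μ) (t := Y m ⁻¹' C n ∪ {ω | 1 / ((n : ℝ) + 1) ≤ ‖r m ω‖}) ?_).trans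
      (measure_union_le _ _)
    intro ω hω
    by_cases hrω : 1 / ((n : ℝ) + 1) ≤ ‖r m ω‖
    · exact Or.inr hrω
    · exact Or.inl (subset_closure ⟨m, hm, ω, rfl, not_le.1 hrω, hω⟩)
  have hI : limsup (fun m => μ (D m ⁻¹' K)) atTop ≤ P.map Y₀ (⋂ n, C n) := by
    have : IsProbabilityMeasure (P.map Y₀) :=
      Measure.isProbabilityMeasure_map hY.aemeasurable_limit
    exact ge_of_tendsto' (tendsto_measure_iInter_atTop
      (fun n => (hC n).measurableSet.nullMeasurableSet) hanti ⟨0, measure_ne_top _ _⟩) hlim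
  refine hI.trans ?_
  rw [Measure.map_apply_of_aemeasurable hY.aemeasurable_limit
    (MeasurableSet.iInter fun n => (hC n).measurableSet)]
  refine measure_mono_ae ?_
  filter_upwards [h] with ω' hω' hmem
  -- A point of every `C n` is approximated by values of `Y m` with m large, `r m` small and `D m`
  -- in `K`; the hypothesis then puts `Z ω'` at distance less than any ε from `K`.
  change Z ω' ∈ K
  rw [← hK.closure_eq, Metric.mem_closure_iff]
  intro ε hε
  obtain ⟨δ, hδ, m₀, hm₀⟩ := hω' ε hε
  obtain ⟨n₁, hn₁⟩ := exists_nat_one_div_lt hδ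
  have hmem' : Y₀ ω' ∈ C (max m₀ n₁) := mem_iInter.1 hmem _
  obtain ⟨y, ⟨m, hm, ω, rfl, h2, h3⟩, hy⟩ := Metric.mem_closure_iff.1 hmem' δ hδ
  refine ⟨D m ω, h3, ?_⟩
  rw [dist_comm, Real.dist_eq]
  refine hm₀ m ((le_max_left _ _).trans hm) ω (by rwa [dist_comm]) (h2.trans_le ?_)
  refine le_trans ?_ hn₁.le
  gcongr
  exact le_max_right _ _

/-! ### Brownian paths are nowhere degenerate: Gaussian increments and the law of large numbers -/

/-- The empirical second moments of independent standard Gaussian vectors converge almost surely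
to the identity matrix. -/
theorem ae_tendsto_sum_mul_div_of_gaussian {Ω' : Type*} [MeasurableSpace Ω'] {p : ℕ}
    {P : Measure Ω'} [IsProbabilityMeasure P] {ξ : Fin p → ℕ → Ω' → ℝ}
    (hξm : ∀ a k, Measurable (ξ a k)) (hlaw : ∀ a k, HasLaw (ξ a k) (gaussianReal 0 1) P)
    (hJ : iIndepFun (fun (q : Fin p × ℕ) ω => ξ q.1 q.2 ω) P) :
    ∀ᵐ ω ∂P, ∀ a b, Tendsto
      (fun n : ℕ => (∑ k ∈ Finset.range n, ξ a k ω * ξ b k ω) / n) atTop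
      (𝓝 (if a = b then 1 else 0)) := by
  have hL2 : ∀ a k, MemLp (ξ a k) 2 P := fun a k => by
    have h := memLp_id_gaussianReal (μ := 0) (v := 1) 2
    rw [← (hlaw a k).map_eq] at h
    exact (memLp_map_measure_iff (by fun_prop) (hξm a k).aemeasurable).1 h
  have hident : ∀ a b k, IdentDistrib (fun ω => (ξ a k ω, ξ b k ω))
      (fun ω => (ξ a 0 ω, ξ b 0 ω)) P P := by
    intro a b k
    refine ⟨by fun_prop, by fun_prop, ?_⟩
    rcases eq_or_ne a b with rfl | hab
    · exact (((hlaw a k).identDistrib (hlaw a 0)).comp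
        (u := fun x => (x, x)) (by fun_prop)).map_eq
    · have h1 : ∀ k, ξ a k ⟂ᵢ[P] ξ b k := fun k =>
        hJ.indepFun (i := (a, k)) (j := (b, k)) (by simp [hab])
      rw [(indepFun_iff_map_prod_eq_prod_map_map (hξm a k).aemeasurable
          (hξm b k).aemeasurable).1 (h1 k),
        (indepFun_iff_map_prod_eq_prod_map_map (hξm a 0).aemeasurable
          (hξm b 0).aemeasurable).1 (h1 0), (hlaw a k).map_eq, (hlaw b k).map_eq,
        (hlaw a 0).map_eq, (hlaw b 0).map_eq]
  have hmean : ∀ a b, ∫ ω, ξ a 0 ω * ξ b 0 ω ∂P = if a = b then 1 else 0 := by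
    intro a b
    have h0 : ∀ a, ∫ ω, ξ a 0 ω ∂P = 0 := fun a => by
      rw [(hlaw a 0).integral_eq, integral_id_gaussianReal]
    split_ifs with hab
    · subst hab
      have h1 : Var[ξ a 0; P] = 1 := by
        rw [(hlaw a 0).variance_eq, variance_id_gaussianReal]; rfl
      rw [variance_of_integral_eq_zero (hξm a 0).aemeasurable (h0 a)] at h1
      simpa [sq] using h1
    · rw [(hJ.indepFun (i := (a, 0)) (j := (b, 0)) (by simp [hab])).integral_fun_mul_eq_mul_integral
        (hξm a 0).aestronglyMeasurable (hξm b 0).aestronglyMeasurable, h0]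
      simp
  have hslln : ∀ a b, ∀ᵐ ω ∂P, Tendsto
      (fun n : ℕ => (∑ k ∈ Finset.range n, ξ a k ω * ξ b k ω) / n) atTop
      (𝓝 (if a = b then 1 else 0)) := by
    intro a b
    rw [← hmean a b]
    refine strong_law_ae_real (fun k ω => ξ a k ω * ξ b k ω)
      ((hL2 a 0).integrable_mul (hL2 b 0)) ?_ ?_
    · intro k l hkl
      exact (hJ.indepFun_prodMk_prodMk (fun q => hξm q.1 q.2) (a, k) (b, k) (a, l) (b, l)
        (by simp [hkl]) (by simp [hkl]) (by simp [hkl]) (by simp [hkl])).comp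
        (φ := fun x : ℝ × ℝ => x.1 * x.2) (ψ := fun x : ℝ × ℝ => x.1 * x.2)
        (by fun_prop) (by fun_prop)
    · intro k
      exact (hident a b k).comp (u := fun x : ℝ × ℝ => x.1 * x.2) (by fun_prop)
  exact ae_all_iff.2 fun a => ae_all_iff.2 fun b => hslln a b

/-- Almost surely, no nontrivial linear combination of the coordinates of a Brownian motion has a
linear path on `[0, 1]`. -/
theorem IsStdBrownianMotion.ae_forall_linear_eq_zero {Ω' : Type*} [MeasurableSpace Ω'] {p : ℕ}
    {W : ℝ≥0 → Ω' → Vec p} {P : Measure Ω'} [IsProbabilityMeasure P]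
    (hW : IsStdBrownianMotion W P) :
    ∀ᵐ ω ∂P, ∀ (v : Fin p → ℝ) (c : ℝ),
      (∀ t : ℝ≥0, t ≤ 1 → ∑ a, v a * W t ω a = c * t) → v = 0 := by
  -- Infinitely many disjoint intervals inside [0, 1], with lengths 2^-(k+1): the increments over
  -- them, rescaled to unit variance, are independent standard Gaussians. A linear path would have
  -- rescaled increments tending to 0.
  let t : ℕ → ℝ≥0 := fun k => 1 - (1 / 2) ^ k
  have ht1 : ∀ k, t k ≤ 1 := fun k => tsub_le_self
  have htc : ∀ k, (t k : ℝ) = 1 - (1 / 2) ^ k := fun k => by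
    have : ((1 : ℝ≥0) / 2) ^ k ≤ 1 := pow_le_one₀ (by positivity) (by
      rw [div_le_one (by norm_num)]; norm_num)
    simp only [t]
    rw [NNReal.coe_sub this]
    simp
  have htm : Monotone t := fun k l hkl => by
    rw [← NNReal.coe_le_coe, htc, htc]
    have : ((1 : ℝ) / 2) ^ l ≤ (1 / 2) ^ k :=
      pow_le_pow_of_le_one (by norm_num) (by norm_num) hkl
    linarith
  have htd : ∀ k, (t (k + 1) : ℝ) - t k = (1 / 2) ^ (k + 1) := fun k => by
    rw [htc, htc]; ring
  let ξ : Fin p → ℕ → Ω' → ℝ := fun a k ω =>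
    √(2 ^ (k + 1)) * (W (t (k + 1)) ω a - W (t k) ω a)
  have hWm : ∀ s a, Measurable fun ω => W s ω a := fun s a =>
    (EuclideanSpace.proj (𝕜 := ℝ) a).continuous.measurable.comp (hW.measurable s)
  have hξm : ∀ a k, Measurable (ξ a k) := fun a k =>
    ((hWm _ a).sub (hWm _ a)).const_mul _
  have hlaw : ∀ a k, HasLaw (ξ a k) (gaussianReal 0 1) P := by
    intro a k
    have h1 := gaussianReal_const_mul
      ((hW.coord a).toIsPreBrownianReal.hasLaw_sub (t (k + 1)) (t k)) (√(2 ^ (k + 1)))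
    convert h1 using 2
    · rfl
    · simp
    · apply NNReal.eq
      rw [NNReal.coe_mul]
      simp only [NNReal.coe_mk, NNReal.coe_one]
      rw [Real.sq_sqrt (by positivity)]
      change (1 : ℝ) = 2 ^ (k + 1) * dist (t (k + 1) : ℝ) (t k)
      rw [Real.dist_eq, htd, abs_of_nonneg (by positivity), ← mul_pow]
      norm_num
  have hJ : iIndepFun (fun (q : Fin p × ℕ) ω => ξ q.1 q.2 ω) P := by
    refine iIndepFun_uncurry' hξm ?_ ?_
    · refine hW.indep.comp (fun _ x k => √(2 ^ (k + 1)) * (x (t (k + 1)) - x (t k))) ?_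
      intro a
      fun_prop
    · intro a
      refine ((hW.coord a).toIsPreBrownianReal.hasIndepIncrements.nat htm).comp
        (fun k x => √(2 ^ (k + 1)) * x) ?_
      intro k
      fun_prop
  -- The exceptional null set concerns only the matrix of second moments, so it serves all v and c
  -- at once. Averaging the squares of v · ξ_k gives |v|² on the one hand and 0 on the other.
  filter_upwards [ae_tendsto_sum_mul_div_of_gaussian hξm hlaw hJ] with ω hω v c hlin
  have hsq : ∀ k, ∑ a, ∑ b, v a * v b * (ξ a k ω * ξ b k ω) = c ^ 2 * (1 / 2) ^ (k + 1) := by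
    intro k
    have h1 : ∑ a, v a * ξ a k ω = √(2 ^ (k + 1)) * (c * (1 / 2) ^ (k + 1)) := by
      rw [← htd k, mul_sub, ← hlin _ (ht1 _), ← hlin _ (ht1 _), ← Finset.sum_sub_distrib,
        Finset.mul_sum]
      exact Finset.sum_congr rfl fun a _ => by simp only [ξ]; ring
    have h2 : ∑ a, ∑ b, v a * v b * (ξ a k ω * ξ b k ω) = (∑ a, v a * ξ a k ω) ^ 2 := by
      rw [sq, Finset.sum_mul_sum]
      exact Finset.sum_congr rfl fun a _ => Finset.sum_congr rfl fun b _ => by ring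
    rw [h2, h1, mul_pow, Real.sq_sqrt (by positivity), mul_pow, sq ((1 / 2 : ℝ) ^ (k + 1))]
    have : (2 : ℝ) ^ (k + 1) * (1 / 2) ^ (k + 1) = 1 := by rw [← mul_pow]; norm_num
    linear_combination c ^ 2 * (1 / 2) ^ (k + 1) * this
  have hlim1 : Tendsto (fun n : ℕ => ∑ a, ∑ b, v a * v b *
      ((∑ k ∈ Finset.range n, ξ a k ω * ξ b k ω) / n)) atTop
      (𝓝 (∑ a, ∑ b, v a * v b * (if a = b then 1 else 0))) :=
    tendsto_finsetSum _ fun a _ => tendsto_finsetSum _ fun b _ => (hω a b).const_mul _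
  have hlim2 : Tendsto (fun n : ℕ => ∑ a, ∑ b, v a * v b *
      ((∑ k ∈ Finset.range n, ξ a k ω * ξ b k ω) / n)) atTop (𝓝 0) := by
    have h0 : Tendsto (fun k : ℕ => c ^ 2 * (1 / 2 : ℝ) ^ (k + 1)) atTop (𝓝 0) := by
      simpa using ((tendsto_add_atTop_iff_nat 1).2
        (tendsto_pow_atTop_nhds_zero_of_lt_one (r := (1 / 2 : ℝ)) (by norm_num)
          (by norm_num))).const_mul (c ^ 2)
    refine h0.cesaro.congr fun n => ?_
    simp_rw [← hsq, Finset.mul_sum, Finset.sum_div, Finset.mul_sum]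
    rw [Finset.sum_comm]
    refine Finset.sum_congr rfl fun a _ => ?_
    rw [Finset.sum_comm]
    exact Finset.sum_congr rfl fun b _ => Finset.sum_congr rfl fun k _ => by ring
  have hzero := tendsto_nhds_unique hlim1 hlim2
  simp only [mul_ite, mul_one, mul_zero, Finset.sum_ite_eq, Finset.mem_univ, if_true] at hzero
  funext a
  simpa using (Finset.sum_eq_zero_iff_of_nonneg fun a _ => mul_self_nonneg (v a)).1 hzero a
    (Finset.mem_univ a)

/-! ### Discretization: maxima over grids and Riemann sums -/

/-- A weighted supremum over the triangle `1 ≤ s ≤ t ≤ T + 1` is approximated by maxima over grids;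
the weight function need only be monotone. -/
theorem exists_abs_iSup_grid_sub_lt {T : ℝ} (hT : 0 < T) {w : ℝ → ℝ}
    (hw_mono : MonotoneOn w (Icc 0 T)) (hw_pos : ∀ t ∈ Icc 0 T, 0 < w t) {g : ℝ → ℝ → ℝ}
    (hg : ContinuousOn (fun q : ℝ × ℝ => g q.1 q.2) {q | 1 ≤ q.1 ∧ q.1 ≤ q.2 ∧ q.2 ≤ T + 1})
    (hg0 : ∀ s t, 1 ≤ s → s ≤ t → t ≤ T + 1 → 0 ≤ g s t) (hdiag : ∀ t, g t t = 0)
    {ε : ℝ} (hε : 0 < ε) :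
    ∃ ε₁ > 0, ∃ m₀ : ℕ, ∀ m ≥ m₀, ∀ G : ℕ → ℕ → ℝ,
      (∀ j k : ℕ, j < k → (k : ℝ) ≤ T * m →
        |G j k - g (1 + (j : ℝ) / m) (1 + (k : ℝ) / m)| ≤ ε₁) →
      |(⨆ k : Finset.Icc 1 ⌊T * (m : ℝ)⌋₊, (⨆ j : Fin k, G j k) / w (((k : ℕ) : ℝ) / m)) -
        ⨆ t : Icc (1 : ℝ) (T + 1), ⨆ s : Icc (1 : ℝ) (t : ℝ),
          |g (s : ℝ) (t : ℝ)| / w ((t : ℝ) - 1)| < ε := by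
  set K : Set (ℝ × ℝ) := {q | 1 ≤ q.1 ∧ q.1 ≤ q.2 ∧ q.2 ≤ T + 1} with hK
  have hKc : IsCompact K := by
    refine (isCompact_Icc (a := ((1 : ℝ), (1 : ℝ))) (b := (T + 1, T + 1))).of_isClosed_subset ?_ ?_
    · exact (isClosed_le continuous_const continuous_fst).inter
        ((isClosed_le continuous_fst continuous_snd).inter
          (isClosed_le continuous_snd continuous_const))
    · rintro ⟨s, t⟩ ⟨h1, h2, h3⟩
      exact ⟨⟨h1, h1.trans h2⟩, ⟨h2.trans h3, h3⟩⟩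
  have hw0 : 0 < w 0 := hw_pos 0 ⟨le_rfl, hT.le⟩
  have hwle : ∀ t ∈ Icc 0 T, w 0 ≤ w t := fun t ht => hw_mono ⟨le_rfl, hT.le⟩ ht ht.1
  obtain ⟨C, hC⟩ := hKc.exists_bound_of_continuousOn hg
  have hbd : ∀ s t, 1 ≤ s → s ≤ t → t ≤ T + 1 → |g s t| / w (t - 1) ≤ C / w 0 := by
    intro s t h1 h2 h3
    have h := hC (s, t) ⟨h1, h2, h3⟩
    rw [Real.norm_eq_abs] at h
    exact div_le_div₀ ((abs_nonneg _).trans h) h hw0 (hwle _ ⟨by linarith, by linarith⟩)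
  have hle : ∀ s t, 1 ≤ s → s ≤ t → t ≤ T + 1 → |g s t| / w (t - 1) ≤
      ⨆ t : Icc (1 : ℝ) (T + 1), ⨆ s : Icc (1 : ℝ) (t : ℝ),
        |g (s : ℝ) (t : ℝ)| / w ((t : ℝ) - 1) := by
    intro s t h1 h2 h3
    refine le_ciSup_of_le ⟨C / w 0, ?_⟩ (⟨t, h1.trans h2, h3⟩ : Icc (1 : ℝ) (T + 1)) ?_
    · rintro _ ⟨t', rfl⟩
      have : Nonempty (Icc (1 : ℝ) (t' : ℝ)) := ⟨⟨1, le_rfl, t'.2.1⟩⟩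
      exact ciSup_le fun s' => hbd _ _ s'.2.1 s'.2.2 t'.2.2
    · refine le_ciSup_of_le (f := fun s : Icc (1 : ℝ) t => |g (s : ℝ) t| / w (t - 1))
        ⟨C / w 0, ?_⟩ (⟨s, h1, h2⟩ : Icc (1 : ℝ) t) le_rfl
      rintro _ ⟨s', rfl⟩
      exact hbd _ _ s'.2.1 s'.2.2 h3
  set L := ⨆ t : Icc (1 : ℝ) (T + 1), ⨆ s : Icc (1 : ℝ) (t : ℝ),
        |g (s : ℝ) (t : ℝ)| / w ((t : ℝ) - 1) with hL
  -- Since w ≥ w 0, an error ε₁ in g costs at most ε/3 after weighting, and at most two such errors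
  -- occur.
  set ε₁ := ε * w 0 / 3 with hε₁
  have hε₁0 : 0 < ε₁ := by positivity
  have hε₁w : ε₁ / w 0 = ε / 3 := by rw [hε₁]; field_simp
  obtain ⟨δ, hδ, huc⟩ := Metric.uniformContinuousOn_iff.1
    (hKc.uniformContinuousOn_of_continuous hg) ε₁ hε₁0
  obtain ⟨m₁, hm₁⟩ := exists_nat_gt (1 / δ)
  obtain ⟨m₂, hm₂⟩ := exists_nat_gt (1 / T)
  refine ⟨ε₁, hε₁0, max m₁ m₂, fun m hm G hG => ?_⟩
  have hmm₁ : (m₁ : ℝ) ≤ m := by exact_mod_cast (le_max_left _ _).trans hm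
  have hmm₂ : (m₂ : ℝ) ≤ m := by exact_mod_cast (le_max_right _ _).trans hm
  have hm0 : (0 : ℝ) < m := (by positivity : (0 : ℝ) < 1 / δ).trans (hm₁.trans_le hmm₁)
  have hmδ : 1 / (m : ℝ) < δ := by
    rw [div_lt_comm₀ hm0 hδ]; exact hm₁.trans_le hmm₁
  have hmT : 1 ≤ T * m := by
    have := (div_lt_iff₀' hT).1 (hm₂.trans_le hmm₂); exact this.le
  have hkT : ∀ k : ℕ, k ≤ ⌊T * (m : ℝ)⌋₊ ↔ (k : ℝ) ≤ T * m := fun k =>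
    Nat.le_floor_iff (by positivity)
  have hkI : ∀ k : ℕ, (k : ℝ) ≤ T * m → (k : ℝ) / m ∈ Icc 0 T := fun k hk =>
    ⟨by positivity, by rwa [div_le_iff₀ hm0]⟩
  have hone : 1 ≤ ⌊T * (m : ℝ)⌋₊ := (hkT 1).2 (by simpa using hmT)
  have hne : Nonempty (Finset.Icc 1 ⌊T * (m : ℝ)⌋₊) := ⟨⟨1, by simp [hone]⟩⟩
  have hgrid : ∀ j k : ℕ, j ≤ k → (k : ℝ) ≤ T * m →
      1 ≤ 1 + (j : ℝ) / m ∧ 1 + (j : ℝ) / m ≤ 1 + (k : ℝ) / m ∧ 1 + (k : ℝ) / m ≤ T + 1 := by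
    intro j k hjk hk
    refine ⟨by have : 0 ≤ (j : ℝ) / m := by positivity
               linarith, by gcongr, by linarith [(hkI k hk).2]⟩
  set D := ⨆ k : Finset.Icc 1 ⌊T * (m : ℝ)⌋₊, (⨆ j : Fin k, G j k) / w (((k : ℕ) : ℝ) / m)
    with hD
  have hDle : D ≤ L + ε₁ / w 0 := by
    refine ciSup_le fun k => ?_
    obtain ⟨k, hk⟩ := k
    rw [Finset.mem_Icc, hkT] at hk
    have : Nonempty (Fin k) := ⟨⟨0, hk.1⟩⟩
    have hwk := hw_pos _ (hkI k hk.2)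
    rw [div_le_iff₀ hwk]
    refine ciSup_le fun j => ?_
    obtain ⟨h1, h2, h3⟩ := hgrid j k j.2.le hk.2
    have h4 := (abs_le.1 (hG j k j.2 hk.2)).2
    have h5 := hle _ _ h1 h2 h3
    rw [abs_of_nonneg (hg0 _ _ h1 h2 h3), add_sub_cancel_left, div_le_iff₀ hwk] at h5
    have h6 : ε₁ ≤ ε₁ / w 0 * w ((k : ℝ) / m) := by
      rw [div_mul_eq_mul_div, le_div_iff₀ hw0]
      exact mul_le_mul_of_nonneg_left (hwle _ (hkI k hk.2)) hε₁0.le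
    rw [add_mul]
    linarith
  have hGD : ∀ j k : ℕ, j < k → (k : ℝ) ≤ T * m → G j k / w ((k : ℝ) / m) ≤ D := by
    intro j k hjk hk
    have hwk := hw_pos _ (hkI k hk)
    refine le_ciSup_of_le (Set.finite_range _).bddAbove
      ⟨k, Finset.mem_Icc.2 ⟨by omega, (hkT k).2 hk⟩⟩ ?_
    refine div_le_div_of_nonneg_right ?_ hwk.le
    exact le_ciSup (f := fun j : Fin k => G j k) (Set.finite_range _).bddAbove ⟨j, hjk⟩
  -- Needed for points (s, t) whose grid cell lies on the diagonal j = k, which the maximum omits.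
  have hDge : -(ε₁ / w 0) ≤ D := by
    have hk : ((1 : ℕ) : ℝ) ≤ T * m := by simpa using hmT
    obtain ⟨h1, h2, h3⟩ := hgrid 0 1 zero_le_one hk
    refine le_trans ?_ (hGD 0 1 zero_lt_one hk)
    have h4 := (abs_le.1 (hG 0 1 zero_lt_one hk)).1
    have h5 := hg0 _ _ h1 h2 h3
    have hwk := hw_pos _ (hkI 1 hk)
    have h6 : ε₁ / w (((1 : ℕ) : ℝ) / m) ≤ ε₁ / w 0 :=
      div_le_div_of_nonneg_left hε₁0.le hw0 (hwle _ (hkI 1 hk))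
    have h7 : -ε₁ / w (((1 : ℕ) : ℝ) / m) ≤ G 0 1 / w (((1 : ℕ) : ℝ) / m) :=
      div_le_div_of_nonneg_right (by linarith) hwk.le
    rw [neg_div] at h7
    linarith
  have hLle : L ≤ D + 2 * (ε₁ / w 0) := by
    have : Nonempty (Icc (1 : ℝ) (T + 1)) := ⟨⟨1, le_rfl, by linarith⟩⟩
    refine ciSup_le fun t => ?_
    obtain ⟨t, ht1, htT⟩ := t
    have : Nonempty (Icc (1 : ℝ) t) := ⟨⟨1, le_rfl, ht1⟩⟩
    refine ciSup_le fun s => ?_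
    obtain ⟨s, hs1, hst⟩ := s
    simp only
    rw [abs_of_nonneg (hg0 _ _ hs1 hst htT)]
    have hfl : ∀ u : ℝ, 1 ≤ u → (⌊(u - 1) * m⌋₊ : ℝ) / m ≤ u - 1 ∧
        u - 1 < (⌊(u - 1) * m⌋₊ : ℝ) / m + 1 / m := by
      intro u hu
      have h0 : 0 ≤ (u - 1) * m := mul_nonneg (by linarith) hm0.le
      refine ⟨(div_le_iff₀ hm0).2 (Nat.floor_le h0), ?_⟩
      rw [← add_div, lt_div_iff₀ hm0]
      exact Nat.lt_floor_add_one _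
    set j := ⌊(s - 1) * m⌋₊
    set k := ⌊(t - 1) * m⌋₊
    have hjk : j ≤ k := Nat.floor_mono (by gcongr)
    obtain ⟨hs2, hs3⟩ := hfl s hs1
    obtain ⟨ht2, ht3⟩ := hfl t ht1
    have hk : (k : ℝ) ≤ T * m := by
      rw [← div_le_iff₀ hm0]; linarith
    have hgr := hgrid j k hjk hk
    have hclose : g s t ≤ g (1 + (j : ℝ) / m) (1 + (k : ℝ) / m) + ε₁ := by
      have h := huc (s, t) ⟨hs1, hst, htT⟩ (1 + (j : ℝ) / m, 1 + (k : ℝ) / m) hgr (by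
        rw [Prod.dist_eq, max_lt_iff, Real.dist_eq, Real.dist_eq, abs_lt, abs_lt]
        exact ⟨⟨by linarith, by linarith⟩, by linarith, by linarith⟩)
      rw [Real.dist_eq] at h
      linarith [(abs_lt.1 h).2]
    have htI : t - 1 ∈ Icc 0 T := ⟨by linarith, by linarith⟩
    have hwt := hw_pos _ htI
    -- Rounding t down gives w(k/m) ≤ w(t - 1), so monotonicity alone controls the weight, without
    -- continuity. When j = k, the vanishing of g on the diagonal makes g s t at most ε₁.
    rcases hjk.lt_or_eq with hlt | heq
    · have h4 := (abs_le.1 (hG j k hlt hk)).1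
      have hwk := hw_pos _ (hkI k hk)
      calc g s t / w (t - 1) ≤ g s t / w ((k : ℝ) / m) :=
            div_le_div_of_nonneg_left (hg0 _ _ hs1 hst htT) hwk
              (hw_mono (hkI k hk) htI ht2)
        _ ≤ (G j k + 2 * ε₁) / w ((k : ℝ) / m) :=
            div_le_div_of_nonneg_right (by linarith) hwk.le
        _ = G j k / w ((k : ℝ) / m) + 2 * (ε₁ / w ((k : ℝ) / m)) := by ring
        _ ≤ D + 2 * (ε₁ / w 0) := by
            have h6 : ε₁ / w ((k : ℝ) / m) ≤ ε₁ / w 0 :=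
              div_le_div_of_nonneg_left hε₁0.le hw0 (hwle _ (hkI k hk))
            linarith [hGD j k hlt hk]
    · rw [heq, hdiag, zero_add] at hclose
      have h1 : g s t / w (t - 1) ≤ ε₁ / w 0 :=
        div_le_div₀ hε₁0.le hclose hw0 (hwle _ htI)
      linarith
  rw [abs_lt]
  rw [hε₁w] at hDle hLle
  constructor <;> linarith

/-- Riemann sums with approximate values of the integrand. -/
theorem abs_sum_Icc_sub_integral_le {f : ℝ → ℝ} (hf : Continuous f) {c : ℕ → ℝ} {m : ℝ}
    (hm : 0 < m) {e : ℝ} {a k : ℕ} (hak : a ≤ k)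
    (h : ∀ j ∈ Finset.Icc (a + 1) k, ∀ r ∈ Icc (((j : ℝ) - 1) / m) ((j : ℝ) / m),
      |c j - f r| ≤ e) :
    |m⁻¹ * ∑ j ∈ Finset.Icc (a + 1) k, c j - ∫ r in ((a : ℝ) / m)..((k : ℝ) / m), f r| ≤
      ((k : ℝ) - a) / m * e := by
  induction k, hak using Nat.le_induction with
  | base => simp
  | succ k hak ih =>
    have ih' := ih fun j hj => h j (by
      rw [Finset.mem_Icc] at hj ⊢; exact ⟨hj.1, hj.2.trans (Nat.le_succ k)⟩)
    rw [Finset.sum_Icc_succ_top (by omega),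
      ← intervalIntegral.integral_add_adjacent_intervals (hf.intervalIntegrable _ ((k : ℝ) / m))
        (hf.intervalIntegrable _ _)]
    have hle : (k : ℝ) / m ≤ ((k + 1 : ℕ) : ℝ) / m := by
      gcongr
      simp
    have hlen : ((k + 1 : ℕ) : ℝ) / m - (k : ℝ) / m = m⁻¹ := by
      push_cast; field_simp; ring
    have hstep : |m⁻¹ * c (k + 1) -
        ∫ r in ((k : ℝ) / m)..(((k + 1 : ℕ) : ℝ) / m), f r| ≤ m⁻¹ * e := by
      have h1 : m⁻¹ * c (k + 1) - ∫ r in ((k : ℝ) / m)..(((k + 1 : ℕ) : ℝ) / m), f r =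
          ∫ r in ((k : ℝ) / m)..(((k + 1 : ℕ) : ℝ) / m), (c (k + 1) - f r) := by
        rw [intervalIntegral.integral_sub (by simp) (hf.intervalIntegrable _ _),
          intervalIntegral.integral_const, hlen, smul_eq_mul]
      rw [h1, ← Real.norm_eq_abs]
      refine (intervalIntegral.norm_integral_le_of_norm_le_const (C := e) fun r hr => ?_).trans ?_
      · rw [uIoc_of_le hle] at hr
        refine h (k + 1) (by rw [Finset.mem_Icc]; omega) r ⟨?_, hr.2⟩
        push_cast
        simpa using hr.1.le
      · rw [hlen, abs_of_pos (by positivity), mul_comm]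
    have hsplit : ((k + 1 : ℕ) : ℝ) - a = ((k : ℝ) - a) + 1 := by push_cast; ring
    rw [hsplit, add_div, add_mul, one_div]
    calc _ = |(m⁻¹ * ∑ j ∈ Finset.Icc (a + 1) k, c j - ∫ r in ((a : ℝ) / m)..((k : ℝ) / m), f r) +
          (m⁻¹ * c (k + 1) - ∫ r in ((k : ℝ) / m)..(((k + 1 : ℕ) : ℝ) / m), f r)| := by
            congr 1; ring
      _ ≤ _ := (abs_add_le _ _).trans (add_le_add ih' hstep)

variable {p : ℕ}

/-! ### Self-normalized quadratic forms -/

/-- Cramer's rule, valid for singular M because both conventions return 0. It yields measurability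
everywhere and continuity where the determinant is nonzero. -/
theorem quadForm_inv (M : Matrix (Fin p) (Fin p) ℝ) (v : Vec p) :
    quadForm M⁻¹ v = M.det⁻¹ * quadForm M.adjugate v := by
  simp [quadForm, Matrix.inv_def, Ring.inverse_eq_inv', Matrix.smul_mulVec, dotProduct_smul]

theorem quadForm_inv_smul {c : ℝ} (hc : c ≠ 0) (M : Matrix (Fin p) (Fin p) ℝ) (v : Vec p) :
    quadForm (c • M)⁻¹ v = c⁻¹ * quadForm M⁻¹ v := by
  have h : (c • M)⁻¹ = c⁻¹ • M⁻¹ := by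
    have := invertibleOfNonzero hc
    by_cases hM : IsUnit M.det
    · rw [Matrix.inv_smul M c hM, invOf_eq_inv]
    · have h1 : ¬ IsUnit (c • M).det := by
        rw [isUnit_iff_ne_zero, not_not] at hM ⊢
        rw [Matrix.det_smul, hM, mul_zero]
      rw [Matrix.nonsing_inv_apply_not_isUnit _ hM, Matrix.nonsing_inv_apply_not_isUnit _ h1,
        smul_zero]
  simp [quadForm, h, Matrix.smul_mulVec, dotProduct_smul]

theorem quadForm_smul (c : ℝ) (M : Matrix (Fin p) (Fin p) ℝ) (v : Vec p) :
    quadForm M (c • v) = c ^ 2 * quadForm M v := by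
  simp [quadForm, Matrix.mulVec_smul, dotProduct_smul, smul_dotProduct]
  ring

/-- The affine invariance that removes the long-run variance. M may be singular; only A has to be
invertible. -/
theorem quadForm_inv_conj {A : Matrix (Fin p) (Fin p) ℝ} (hA : IsUnit A.det)
    (M : Matrix (Fin p) (Fin p) ℝ) (v : Vec p) :
    quadForm (A * M * Aᵀ)⁻¹ (WithLp.toLp 2 (A *ᵥ v.ofLp)) = quadForm M⁻¹ v := by
  have h1 : A⁻¹ *ᵥ (A *ᵥ v.ofLp) = v.ofLp := by
    rw [Matrix.mulVec_mulVec, Matrix.nonsing_inv_mul _ hA, Matrix.one_mulVec]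
  have h2 : (A *ᵥ v.ofLp) ᵥ* (Aᵀ)⁻¹ = v.ofLp := by
    rw [← Matrix.vecMul_transpose, Matrix.vecMul_vecMul, Matrix.mul_nonsing_inv _ (by rwa [Matrix.det_transpose]),
      Matrix.vecMul_one]
  simp only [quadForm]
  rw [Matrix.mul_inv_rev, Matrix.mul_inv_rev, ← Matrix.mulVec_mulVec, ← Matrix.mulVec_mulVec, h1,
    Matrix.dotProduct_mulVec, h2]

theorem outer_mulVec (A : Matrix (Fin p) (Fin p) ℝ) (v : Vec p) :
    outer (WithLp.toLp 2 (A *ᵥ v.ofLp)) = A * outer v * Aᵀ := by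
  simp only [outer]
  rw [Matrix.mul_vecMulVec, Matrix.vecMulVec_mul, Matrix.vecMul_transpose]

theorem continuous_quadForm_adjugate :
    Continuous fun q : (Fin p → Fin p → ℝ) × Vec p =>
      quadForm (Matrix.of q.1).adjugate q.2 := by
  simp only [quadForm]
  refine Continuous.dotProduct (by fun_prop) (Continuous.matrix_mulVec ?_ (by fun_prop))
  exact Continuous.matrix_adjugate continuous_fst

theorem continuous_det_of :
    Continuous fun q : (Fin p → Fin p → ℝ) × Vec p => (Matrix.of q.1).det :=
  Continuous.matrix_det continuous_fst

theorem continuousAt_quadForm_inv {q : (Fin p → Fin p → ℝ) × Vec p}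
    (hq : (Matrix.of q.1).det ≠ 0) :
    ContinuousAt (fun q : (Fin p → Fin p → ℝ) × Vec p => quadForm (Matrix.of q.1)⁻¹ q.2) q := by
  simp only [quadForm_inv]
  exact (continuous_det_of.continuousAt.inv₀ hq).mul continuous_quadForm_adjugate.continuousAt

theorem measurable_quadForm_inv :
    Measurable fun q : (Fin p → Fin p → ℝ) × Vec p => quadForm (Matrix.of q.1)⁻¹ q.2 := by
  simp only [quadForm_inv]
  exact continuous_det_of.measurable.inv.mul continuous_quadForm_adjugate.measurable

/-! ### The detector as a functional of a triangular array of estimators -/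

/-- `∑_{j=a+1}^{k} (k-j)² (j-a)² (h_{a+1}^j - h_{j+1}^k) (h_{a+1}^j - h_{j+1}^k)ᵀ`. -/
noncomputable def blockMatrix (h : ℕ → ℕ → Vec p) (a k : ℕ) : Matrix (Fin p) (Fin p) ℝ :=
  ∑ j ∈ Finset.Icc (a + 1) k, (((k : ℝ) - j) ^ 2 * ((j : ℝ) - a) ^ 2) •
    outer (h (a + 1) j - h (j + 1) k)

/-- The self-normalized contrast of the first `m + j` against the next `k - j` observations. -/
noncomputable def contrastSN (h : ℕ → ℕ → Vec p) (m j k : ℕ) : ℝ :=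
  m * (((m : ℝ) + j) ^ 2 * ((k : ℝ) - j) ^ 2 *
    quadForm (blockMatrix h 0 (m + j) + blockMatrix h (m + j) (m + k))⁻¹
      (h 1 (m + j) - h (m + j + 1) (m + k)))

/-- The maximal weighted detector of a triangular array of estimators. -/
noncomputable def maxContrastSN (h : ℕ → ℕ → Vec p) (T : ℝ) (w : ℝ → ℝ) (m : ℕ) : ℝ :=
  ⨆ k : Finset.Icc 1 ⌊T * (m : ℝ)⌋₊,
    (⨆ j : Fin k, contrastSN h m j k) / w (((k : ℕ) : ℝ) / m)

/-- Both sums in the self-normalizer are blocks of the same shape, the first one starting at 0, so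
one Riemann sum estimate covers both. -/
theorem maxDetectorSN_eq {Ω : Type*} {d : ℕ} (θ : (Vec d → ℝ) → Vec p) (X : ℤ → Ω → Vec d)
    (T : ℝ) (w : ℝ → ℝ) (m : ℕ) (ω : Ω) :
    maxDetectorSN θ X T w m ω = maxContrastSN (fun i j => thetaHat θ X i j ω) T w m := by
  have hV : ∀ z u, snMatrix θ X z u ω = blockMatrix (fun i j => thetaHat θ X i j ω) 0 z +
      blockMatrix (fun i j => thetaHat θ X i j ω) z u := by
    intro z u
    simp only [snMatrix, blockMatrix, Nat.cast_zero, sub_zero, zero_add]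
    congr 1
    exact Finset.sum_congr rfl fun j _ => by rw [mul_comm]
  simp only [maxDetectorSN, maxContrastSN, detectorSN, contrastSN, hV]
  refine iSup_congr fun k => ?_
  rw [Real.mul_iSup_of_nonneg (Nat.cast_nonneg m)]

theorem blockMatrix_mulVec (A : Matrix (Fin p) (Fin p) ℝ) (h : ℕ → ℕ → Vec p) (a k : ℕ) :
    blockMatrix (fun i j => WithLp.toLp 2 (A *ᵥ (h i j).ofLp)) a k =
      A * blockMatrix h a k * Aᵀ := by
  simp only [blockMatrix, Matrix.mul_sum, Matrix.sum_mul]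
  refine Finset.sum_congr rfl fun j _ => ?_
  have hd : (WithLp.toLp 2 (A *ᵥ (h (a + 1) j).ofLp) - WithLp.toLp 2 (A *ᵥ (h (j + 1) k).ofLp) :
      Vec p) = WithLp.toLp 2 (A *ᵥ (h (a + 1) j - h (j + 1) k).ofLp) := by
    rw [WithLp.ofLp_sub, Matrix.mulVec_sub, WithLp.toLp_sub]
  rw [hd, outer_mulVec, Matrix.mul_smul, Matrix.smul_mul]

theorem maxContrastSN_mulVec {A : Matrix (Fin p) (Fin p) ℝ} (hA : IsUnit A.det)
    (h : ℕ → ℕ → Vec p) (T : ℝ) (w : ℝ → ℝ) (m : ℕ) :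
    maxContrastSN (fun i j => WithLp.toLp 2 (A *ᵥ (h i j).ofLp)) T w m =
      maxContrastSN h T w m := by
  simp only [maxContrastSN, contrastSN, blockMatrix_mulVec]
  simp only [← WithLp.toLp_sub, ← Matrix.mulVec_sub, ← WithLp.ofLp_sub, ← Matrix.mul_add,
    ← Matrix.add_mul, quadForm_inv_conj hA]

theorem aemeasurable_maxContrastSN {Ω : Type*} [MeasurableSpace Ω] {μ : Measure Ω}
    {h : ℕ → ℕ → Ω → Vec p} (hh : ∀ i j, 1 ≤ i → AEMeasurable (h i j) μ) (T : ℝ) (w : ℝ → ℝ)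
    (m : ℕ) : AEMeasurable (fun ω => maxContrastSN (fun i j => h i j ω) T w m) μ := by
  have hb : ∀ a k, AEMeasurable
      (fun ω => (fun α β => blockMatrix (fun i j => h i j ω) a k α β : Fin p → Fin p → ℝ)) μ := by
    intro a k
    refine aemeasurable_pi_lambda _ fun α => aemeasurable_pi_lambda _ fun β => ?_
    simp only [blockMatrix, Matrix.sum_apply, Matrix.smul_apply, outer, Matrix.vecMulVec_apply]
    refine Finset.aemeasurable_fun_sum _ fun j _ => ?_
    have hd : AEMeasurable (fun ω => h (a + 1) j ω - h (j + 1) k ω) μ :=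
      (hh _ _ (by omega)).sub (hh _ _ (by omega))
    have hc : ∀ α, AEMeasurable (fun ω => (h (a + 1) j ω - h (j + 1) k ω).ofLp α) μ := fun α =>
      (EuclideanSpace.proj (𝕜 := ℝ) α).continuous.measurable.comp_aemeasurable hd
    exact ((hc α).mul (hc β)).const_mul _
  refine AEMeasurable.iSup fun k => AEMeasurable.div_const (AEMeasurable.iSup fun j => ?_) _
  refine AEMeasurable.const_mul (AEMeasurable.const_mul ?_ _) _
  exact measurable_quadForm_inv.comp_aemeasurable
    (((hb 0 (m + j)).add (hb (m + j) (m + k))).prodMk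
      ((hh 1 (m + j) le_rfl).sub (hh (m + j + 1) (m + k) (by omega))))

/-! ### The limiting self-normalizer -/

/-- The deviation of a path at `r` from its chord over `[s, t]`, multiplied by `t - s`. -/
noncomputable def chordBridge (x : ℝ → Vec p) (s r t : ℝ) : Vec p :=
  (t - s) • x r - (t - r) • x s - (r - s) • x t

/-- The integrand of N₂ is a bridge over [s, t]; with s = 0 and a path started at 0 it becomes the
integrand of N₁. -/
theorem bridge_add_bridge_sub_bridge (x : ℝ → Vec p) (s r t : ℝ) :
    bridge x r t + bridge x s r - bridge x s t = chordBridge x s r t := by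
  simp only [bridge, chordBridge]
  module

theorem chordBridge_zero {x : ℝ → Vec p} (hx0 : x 0 = 0) (r t : ℝ) :
    chordBridge x 0 r t = bridge x r t := by
  simp [bridge, chordBridge, hx0]

theorem N2_apply (x : ℝ → Vec p) (s t : ℝ) (α β : Fin p) :
    N2 x s t α β = ∫ r in s..t, chordBridge x s r t α * chordBridge x s r t β := by
  simp only [N2, Matrix.of_apply, bridge_add_bridge_sub_bridge]

theorem N1_eq_N2 {x : ℝ → Vec p} (hx0 : x 0 = 0) (s : ℝ) : N1 x s = N2 x 0 s := by
  ext α β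
  simp only [N2_apply, N1, Matrix.of_apply, chordBridge_zero hx0]

theorem continuous_chordBridge {Z : Type*} [TopologicalSpace Z] {x : ℝ → Vec p}
    (hx : Continuous x) {f g k : Z → ℝ} (hf : Continuous f) (hg : Continuous g)
    (hk : Continuous k) : Continuous fun z => chordBridge x (f z) (g z) (k z) := by
  simp only [chordBridge]
  fun_prop

theorem continuous_chordBridge_apply {Z : Type*} [TopologicalSpace Z] {x : ℝ → Vec p}
    (hx : Continuous x) (α : Fin p) {f g k : Z → ℝ} (hf : Continuous f) (hg : Continuous g)
    (hk : Continuous k) : Continuous fun z => chordBridge x (f z) (g z) (k z) α :=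
  (EuclideanSpace.proj (𝕜 := ℝ) α).continuous.comp (continuous_chordBridge hx hf hg hk)

theorem continuous_chordBridge_mul {x : ℝ → Vec p} (hx : Continuous x) (α β : Fin p) (s t : ℝ) :
    Continuous fun r => chordBridge x s r t α * chordBridge x s r t β :=
  (continuous_chordBridge_apply hx α continuous_const continuous_id continuous_const).mul
    (continuous_chordBridge_apply hx β continuous_const continuous_id continuous_const)

theorem continuous_N2 {x : ℝ → Vec p} (hx : Continuous x) (α β : Fin p) :
    Continuous fun q : ℝ × ℝ => N2 x q.1 q.2 α β := by
  let f : ℝ × ℝ → ℝ → ℝ := fun q r => chordBridge x q.1 r q.2 α * chordBridge x q.1 r q.2 β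
  have hc : Continuous (Function.uncurry f) := by
    have hα : ∀ α, Continuous fun u : (ℝ × ℝ) × ℝ => chordBridge x u.1.1 u.2 u.1.2 α :=
      fun α => continuous_chordBridge_apply hx α (by fun_prop) (by fun_prop) (by fun_prop)
    exact (hα α).mul (hα β)
  -- A fixed lower endpoint leaves only the integrand and the upper endpoint depending on q.
  have h1 : ∀ q : ℝ × ℝ, N2 x q.1 q.2 α β =
      (∫ r in (0 : ℝ)..q.2, f q r) - ∫ r in (0 : ℝ)..q.1, f q r := by
    intro q
    rw [N2_apply, intervalIntegral.integral_interval_sub_left] <;>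
      exact (continuous_chordBridge_mul hx α β _ _).intervalIntegrable _ _
  simp only [h1]
  exact (intervalIntegral.continuous_parametric_intervalIntegral_of_continuous hc
    continuous_snd).sub
    (intervalIntegral.continuous_parametric_intervalIntegral_of_continuous hc continuous_fst)

theorem quadForm_N2 {x : ℝ → Vec p} (hx : Continuous x) (s t : ℝ) (v : Fin p → ℝ) :
    v ⬝ᵥ (N2 x s t *ᵥ v) = ∫ r in s..t, (∑ α, v α * chordBridge x s r t α) ^ 2 := by
  have h : ∀ r, (∑ α, v α * chordBridge x s r t α) ^ 2 =
      ∑ α, ∑ β, v α * v β * (chordBridge x s r t α * chordBridge x s r t β) := by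
    intro r
    rw [sq, Finset.sum_mul_sum]
    exact Finset.sum_congr rfl fun α _ => Finset.sum_congr rfl fun β _ => by ring
  simp only [h]
  have hcont : ∀ α β, Continuous fun r =>
      v α * v β * (chordBridge x s r t α * chordBridge x s r t β) := fun α β =>
    (continuous_chordBridge_mul hx α β s t).const_mul _
  rw [intervalIntegral.integral_finsetSum fun α _ =>
    (continuous_finsetSum _ fun β _ => hcont α β).intervalIntegrable _ _]
  simp only [dotProduct, Matrix.mulVec]
  refine Finset.sum_congr rfl fun α _ => ?_
  rw [intervalIntegral.integral_finsetSum fun β _ =>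
    (hcont α β).intervalIntegrable _ _, Finset.mul_sum]
  refine Finset.sum_congr rfl fun β _ => ?_
  rw [intervalIntegral.integral_const_mul, N2_apply]
  ring

theorem isHermitian_N2 (x : ℝ → Vec p) (s t : ℝ) : (N2 x s t).IsHermitian := by
  ext α β
  simp [N2_apply, mul_comm]

theorem posSemidef_N2 {x : ℝ → Vec p} (hx : Continuous x) {s t : ℝ} (hst : s ≤ t) :
    (N2 x s t).PosSemidef := by
  refine Matrix.PosSemidef.of_dotProduct_mulVec_nonneg (isHermitian_N2 x s t) fun v => ?_
  rw [star_trivial, quadForm_N2 hx]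
  exact intervalIntegral.integral_nonneg hst fun r _ => sq_nonneg _

/-- If no nontrivial linear combination of the coordinates of a path is linear on `[0, 1]`, then
the self-normalizer is positive definite. -/
theorem posDef_N1_add_N2 {x : ℝ → Vec p} (hx : Continuous x) (hx0 : x 0 = 0)
    (hlin : ∀ (v : Fin p → ℝ) (c : ℝ),
      (∀ t ∈ Icc (0 : ℝ) 1, ∑ α, v α * x t α = c * t) → v = 0)
    {s t : ℝ} (hs : 1 ≤ s) (hst : s ≤ t) : (N1 x s + N2 x s t).PosDef := by
  refine Matrix.PosDef.add_posSemidef ?_ (posSemidef_N2 hx hst)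
  rw [N1_eq_N2 hx0]
  refine Matrix.PosDef.of_dotProduct_mulVec_pos (isHermitian_N2 x 0 s) fun {v} hv => ?_
  rw [star_trivial, quadForm_N2 hx]
  have hs0 : 0 < s := by linarith
  have hcont : Continuous fun r => (∑ α, v α * chordBridge x 0 r s α) ^ 2 := by
    refine Continuous.pow (continuous_finsetSum _ fun α _ => ?_) 2
    exact (continuous_chordBridge_apply hx α continuous_const continuous_id
      continuous_const).const_mul _
  refine intervalIntegral.integral_pos hs0 hcont.continuousOn (fun r _ => sq_nonneg _) ?_
  -- If the integrand vanishes on [0, s], then s (v · x(r)) = r (v · x(s)) there, so v · x is linear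
  -- with slope v · x(s) / s on [0, 1] ⊆ [0, s].
  by_contra! hall
  refine hv (hlin v ((∑ α, v α * x s α) / s) fun r hr => ?_)
  have h1 := hall r ⟨hr.1, hr.2.trans hs⟩
  have h2 : ∑ α, v α * chordBridge x 0 r s α = 0 :=
    pow_eq_zero_iff (two_ne_zero) |>.1 (le_antisymm h1 (sq_nonneg _))
  have h3 : ∑ α, v α * chordBridge x 0 r s α =
      s * ∑ α, v α * x r α - r * ∑ α, v α * x s α := by
    rw [Finset.mul_sum, Finset.mul_sum, ← Finset.sum_sub_distrib]
    refine Finset.sum_congr rfl fun α _ => ?_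
    rw [chordBridge_zero hx0]
    simp [bridge]
    ring
  rw [h3] at h2
  field_simp
  linarith

theorem det_N1_add_N2_ne_zero {x : ℝ → Vec p} (hx : Continuous x) (hx0 : x 0 = 0)
    (hlin : ∀ (v : Fin p → ℝ) (c : ℝ),
      (∀ t ∈ Icc (0 : ℝ) 1, ∑ α, v α * x t α = c * t) → v = 0)
    {s t : ℝ} (hs : 1 ≤ s) (hst : s ≤ t) : (N1 x s + N2 x s t).det ≠ 0 :=
  (posDef_N1_add_N2 hx hx0 hlin hs hst).det_pos.ne'

theorem bridgeSN_nonneg {x : ℝ → Vec p} (hx : Continuous x) (hx0 : x 0 = 0)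
    (hlin : ∀ (v : Fin p → ℝ) (c : ℝ),
      (∀ t ∈ Icc (0 : ℝ) 1, ∑ α, v α * x t α = c * t) → v = 0)
    {s t : ℝ} (hs : 1 ≤ s) (hst : s ≤ t) : 0 ≤ bridgeSN x s t := by
  have h := (posDef_N1_add_N2 hx hx0 hlin hs hst).inv.posSemidef.dotProduct_mulVec_nonneg
    (bridge x s t).ofLp
  rwa [star_trivial] at h

theorem bridgeSN_self (x : ℝ → Vec p) (t : ℝ) : bridgeSN x t t = 0 := by
  simp [bridgeSN, bridge, quadForm]

/-- The entries of the self-normalizer together with the bridge, as a function of `(s, t)`. -/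
noncomputable def limitPair (x : ℝ → Vec p) (q : ℝ × ℝ) : (Fin p → Fin p → ℝ) × Vec p :=
  (fun α β => N2 x 0 q.1 α β + N2 x q.1 q.2 α β, chordBridge x 0 q.1 q.2)

theorem continuous_limitPair {x : ℝ → Vec p} (hx : Continuous x) : Continuous (limitPair x) := by
  refine Continuous.prodMk (continuous_pi fun α => continuous_pi fun β => ?_) ?_
  · exact ((continuous_N2 hx α β).comp
      (by fun_prop : Continuous fun q : ℝ × ℝ => ((0 : ℝ), q.1))).add (continuous_N2 hx α β)
  · exact continuous_chordBridge hx continuous_const continuous_fst continuous_snd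

theorem of_limitPair_fst {x : ℝ → Vec p} (hx0 : x 0 = 0) (q : ℝ × ℝ) :
    Matrix.of (limitPair x q).1 = N1 x q.1 + N2 x q.1 q.2 := by
  rw [N1_eq_N2 hx0]
  rfl

theorem bridgeSN_eq {x : ℝ → Vec p} (hx0 : x 0 = 0) (q : ℝ × ℝ) :
    bridgeSN x q.1 q.2 = quadForm (Matrix.of (limitPair x q).1)⁻¹ (limitPair x q).2 := by
  rw [of_limitPair_fst hx0, bridgeSN, limitPair, chordBridge_zero hx0]

/-! ### Convergence of the detector along a path -/

/-- The centred estimators `(j - i) (h_{i+1}^j - c)` are uniformly close to the increments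
`√m (x(j/m) - x(i/m))` of a path. -/
def IsPathApprox (h : ℕ → ℕ → Vec p) (c : Vec p) (x : ℝ → Vec p) (b : ℝ) (m : ℕ) (δ : ℝ) : Prop :=
  ∀ i j : ℕ, i < j → (j : ℝ) ≤ b * m →
    ‖((j : ℝ) - i) • (h (i + 1) j - c) - √(m : ℝ) • (x ((j : ℝ) / m) - x ((i : ℝ) / m))‖ ≤
      √(m : ℝ) * δ

/-- The contrast `(j - a) (k - j) (h_{a+1}^j - h_{j+1}^k)`, normalized by `m^{-3/2}`. -/
noncomputable def scaledContrast (h : ℕ → ℕ → Vec p) (m a j k : ℕ) : Vec p :=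
  ((m : ℝ) * √(m : ℝ))⁻¹ • ((((j : ℝ) - a) * ((k : ℝ) - j)) • (h (a + 1) j - h (j + 1) k))

/-- The centre c cancels, and the error is the combination (k - j) u - (j - a) v of the two block
errors, at most (k - a) √m δ before division by m^(3/2). -/
theorem IsPathApprox.norm_scaledContrast_sub_le {h : ℕ → ℕ → Vec p} {c : Vec p}
    {x : ℝ → Vec p} {b : ℝ} {m : ℕ} {δ : ℝ} (hh : IsPathApprox h c x b m δ) (hm : 0 < m)
    (hδ : 0 ≤ δ) {a j k : ℕ} (haj : a < j) (hjk : j ≤ k) (hk : (k : ℝ) ≤ b * m) :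
    ‖scaledContrast h m a j k - chordBridge x ((a : ℝ) / m) ((j : ℝ) / m) ((k : ℝ) / m)‖ ≤
      b * δ := by
  have hm' : (0 : ℝ) < m := by exact_mod_cast hm
  have hσ : 0 < √(m : ℝ) := Real.sqrt_pos.2 hm'
  have hajR : (a : ℝ) < j := by exact_mod_cast haj
  have hjkR : (j : ℝ) ≤ k := by exact_mod_cast hjk
  have hu := hh a j haj (hjkR.trans hk)
  have hv : ‖((k : ℝ) - j) • (h (j + 1) k - c) -
      √(m : ℝ) • (x ((k : ℝ) / m) - x ((j : ℝ) / m))‖ ≤ √(m : ℝ) * δ := by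
    -- For j = k the second block is empty and its estimator arbitrary, but its weight k - j is
    -- zero.
    rcases hjk.eq_or_lt with rfl | hlt
    · simp only [sub_self, zero_smul, smul_zero, norm_zero]
      positivity
    · exact hh j k hlt hk
  set u := ((j : ℝ) - a) • (h (a + 1) j - c) - √(m : ℝ) • (x ((j : ℝ) / m) - x ((a : ℝ) / m))
    with hu_def
  set v := ((k : ℝ) - j) • (h (j + 1) k - c) - √(m : ℝ) • (x ((k : ℝ) / m) - x ((j : ℝ) / m))
    with hv_def
  have hkey : scaledContrast h m a j k -
      chordBridge x ((a : ℝ) / m) ((j : ℝ) / m) ((k : ℝ) / m) =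
      ((m : ℝ) * √(m : ℝ))⁻¹ • (((k : ℝ) - j) • u - ((j : ℝ) - a) • v) := by
    rw [hu_def, hv_def, scaledContrast, chordBridge]
    generalize √(m : ℝ) = σ at hσ
    have hσ0 := hσ.ne'
    have hm0 := hm'.ne'
    match_scalars <;> field_simp <;> ring
  rw [hkey, norm_smul, norm_inv, Real.norm_of_nonneg (by positivity), inv_mul_le_iff₀ (by positivity)]
  have h1 : ‖((k : ℝ) - j) • u - ((j : ℝ) - a) • v‖ ≤
      ((k : ℝ) - j) * (√(m : ℝ) * δ) + ((j : ℝ) - a) * (√(m : ℝ) * δ) := by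
    refine (norm_sub_le _ _).trans (add_le_add ?_ ?_)
    · rw [norm_smul, Real.norm_of_nonneg (by linarith)]
      exact mul_le_mul_of_nonneg_left hu (by linarith)
    · rw [norm_smul, Real.norm_of_nonneg (by linarith)]
      exact mul_le_mul_of_nonneg_left hv (by linarith)
  have h2 : ((k : ℝ) - a) * (√(m : ℝ) * δ) ≤ (b * m) * (√(m : ℝ) * δ) := by
    refine mul_le_mul_of_nonneg_right ?_ (by positivity)
    have : (0 : ℝ) ≤ a := Nat.cast_nonneg a
    linarith
  calc _ ≤ _ := h1
    _ = ((k : ℝ) - a) * (√(m : ℝ) * δ) := by ring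
    _ ≤ _ := h2
    _ = _ := by ring

/-- Of the factor m⁴, m³ normalizes the two contrasts and the last m is the mesh of a Riemann sum.
-/
theorem blockMatrix_apply_eq (h : ℕ → ℕ → Vec p) {m : ℕ} (hm : 0 < m) (a k : ℕ) (α β : Fin p) :
    ((m : ℝ) ^ 4)⁻¹ * blockMatrix h a k α β =
      (m : ℝ)⁻¹ * ∑ j ∈ Finset.Icc (a + 1) k,
        scaledContrast h m a j k α * scaledContrast h m a j k β := by
  have hm' : (0 : ℝ) < m := by exact_mod_cast hm
  have hσ2 : √(m : ℝ) ^ 2 = m := Real.sq_sqrt hm'.le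
  have hσ : √(m : ℝ) ≠ 0 := (Real.sqrt_pos.2 hm').ne'
  simp only [blockMatrix, Matrix.sum_apply, Matrix.smul_apply, outer, Matrix.vecMulVec_apply,
    Finset.mul_sum, scaledContrast, PiLp.smul_apply, smul_eq_mul]
  refine Finset.sum_congr rfl fun j _ => ?_
  have h4 : ((m : ℝ) ^ 4)⁻¹ = (m : ℝ)⁻¹ * ((m : ℝ) * √(m : ℝ))⁻¹ ^ 2 := by
    rw [inv_pow, mul_pow, hσ2, ← mul_inv]
    ring
  rw [h4]
  ring

/-- The blocks of the self-normalizing matrix, divided by `m⁴`, are uniformly close to the limiting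
integrals. -/
theorem exists_abs_blockMatrix_sub_le {x : ℝ → Vec p} (hx : Continuous x) {b : ℝ} (hb : 0 < b)
    {ε : ℝ} (hε : 0 < ε) :
    ∃ δ > 0, ∃ m₀ : ℕ, ∀ m ≥ m₀, 0 < m ∧ ∀ (h : ℕ → ℕ → Vec p) (c : Vec p),
      IsPathApprox h c x b m δ → ∀ a k : ℕ, a ≤ k → (k : ℝ) ≤ b * m → ∀ α β,
        |((m : ℝ) ^ 4)⁻¹ * blockMatrix h a k α β -
          N2 x ((a : ℝ) / m) ((k : ℝ) / m) α β| ≤ ε := by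
  have hF : Continuous fun q : ℝ × ℝ × ℝ => chordBridge x q.1 q.2.1 q.2.2 :=
    continuous_chordBridge hx (by fun_prop) (by fun_prop) (by fun_prop)
  have hKc : IsCompact (Icc 0 b ×ˢ Icc 0 b ×ˢ Icc 0 b : Set (ℝ × ℝ × ℝ)) :=
    isCompact_Icc.prod (isCompact_Icc.prod isCompact_Icc)
  obtain ⟨C, hC⟩ := hKc.exists_bound_of_continuousOn hF.continuousOn
  have hC0 : 0 ≤ C := (norm_nonneg _).trans (hC (0, 0, 0) ⟨⟨le_rfl, hb.le⟩, ⟨le_rfl, hb.le⟩,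
    ⟨le_rfl, hb.le⟩⟩)
  -- Coordinates bounded by C and perturbed by e ≤ 1 change their product by at most e (2C + 1); the
  -- integration range has length at most b.
  set e := min 1 (ε / (b * (2 * C + 1))) with he
  have he0 : 0 < e := lt_min one_pos (by positivity)
  have he1 : e ≤ 1 := min_le_left _ _
  have heε : b * (e * (2 * C + 1)) ≤ ε := by
    have h1 : e ≤ ε / (b * (2 * C + 1)) := min_le_right _ _
    rw [le_div_iff₀ (by positivity)] at h1
    linarith
  obtain ⟨δ₁, hδ₁, huc⟩ := Metric.uniformContinuousOn_iff.1
    (hKc.uniformContinuousOn_of_continuous hF.continuousOn) (e / 2) (by positivity)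
  obtain ⟨m₀, hm₀⟩ := exists_nat_gt (1 / δ₁)
  -- Half of e pays for replacing the contrast by the bridge, half for moving r within a mesh cell.
  refine ⟨e / 2 / b, by positivity, m₀, fun m hm => ?_⟩
  have hm₀m : 1 / δ₁ < m := hm₀.trans_le (by exact_mod_cast hm)
  have hm' : (0 : ℝ) < m := (by positivity : (0 : ℝ) < 1 / δ₁).trans hm₀m
  have hmpos : 0 < m := by exact_mod_cast hm'
  have hmδ : 1 / (m : ℝ) < δ₁ := by rwa [div_lt_comm₀ hm' hδ₁]
  refine ⟨hmpos, fun h c hh a k hak hk α β => ?_⟩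
  have hI : ∀ i : ℕ, i ≤ k → (i : ℝ) / m ∈ Icc 0 b := fun i hi => by
    have hik : (i : ℝ) ≤ k := by exact_mod_cast hi
    exact ⟨by positivity, by rw [div_le_iff₀ hm']; linarith⟩
  rw [blockMatrix_apply_eq h hmpos, N2_apply]
  refine (abs_sum_Icc_sub_integral_le (e := e * (2 * C + 1))
    (continuous_chordBridge_mul hx α β _ _) hm' hak ?_).trans ?_
  · intro j hj r hr
    rw [Finset.mem_Icc] at hj
    have hjI := hI j hj.2
    have h1j : (1 : ℝ) ≤ j := by exact_mod_cast (Nat.le_add_left 1 a).trans hj.1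
    have hrI : r ∈ Icc 0 b :=
      ⟨le_trans (div_nonneg (by linarith) hm'.le) hr.1, hr.2.trans hjI.2⟩
    have h1 := hh.norm_scaledContrast_sub_le hmpos (by positivity) (a := a) (j := j) hj.1 hj.2 hk
    rw [mul_div_cancel₀ _ hb.ne'] at h1
    have h2 := huc ((a : ℝ) / m, (j : ℝ) / m, (k : ℝ) / m) ⟨hI a hak, hjI, hI k le_rfl⟩
      ((a : ℝ) / m, r, (k : ℝ) / m) ⟨hI a hak, hrI, hI k le_rfl⟩ (by
        rw [Prod.dist_eq, Prod.dist_eq, dist_self, dist_self]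
        refine max_lt hδ₁ (max_lt ?_ hδ₁)
        refine lt_of_le_of_lt ?_ hmδ
        rw [Real.dist_eq, abs_le]
        have hr1 := hr.1
        rw [sub_div] at hr1
        have : 0 < 1 / (m : ℝ) := by positivity
        constructor <;> linarith [hr.2])
    rw [dist_eq_norm] at h2
    set Q := scaledContrast h m a j k
    set B := chordBridge x ((a : ℝ) / m) r ((k : ℝ) / m)
    have hQB : ‖Q - B‖ ≤ e := by
      refine (norm_sub_le_norm_sub_add_norm_sub _
        (chordBridge x ((a : ℝ) / m) ((j : ℝ) / m) ((k : ℝ) / m)) _).trans ?_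
      linarith
    have hB : ‖B‖ ≤ C := hC ((a : ℝ) / m, r, (k : ℝ) / m) ⟨hI a hak, hrI, hI k le_rfl⟩
    have hcoord : ∀ α, |Q α - B α| ≤ e := fun α =>
      (by simpa using PiLp.norm_apply_le (Q - B) α : |Q α - B α| ≤ ‖Q - B‖).trans hQB
    have hBc : ∀ α, |B α| ≤ C := fun α => (PiLp.norm_apply_le B α).trans hB
    have hsplit : Q α * Q β - B α * B β =
        (Q α - B α) * (Q β - B β) + (Q α - B α) * B β + B α * (Q β - B β) := by ring
    rw [hsplit]
    calc _ ≤ |Q α - B α| * |Q β - B β| + |Q α - B α| * |B β| + |B α| * |Q β - B β| := by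
          refine (abs_add_three _ _ _).trans ?_
          rw [abs_mul, abs_mul, abs_mul]
      _ ≤ e * 1 + e * C + C * e := by
          have := hcoord α
          have := (hcoord β).trans he1
          have := hcoord β
          have := hBc α
          have := hBc β
          gcongr
      _ = e * (2 * C + 1) := by ring
  · refine le_trans (mul_le_mul_of_nonneg_right ?_ (by positivity)) heε
    rw [div_le_iff₀ hm']
    have : (0 : ℝ) ≤ a := Nat.cast_nonneg a
    linarith

/-- The contrast depends on the estimators through scaled versions of the self-normalizing matrix
and of the difference of the estimators. -/
theorem contrastSN_eq (h : ℕ → ℕ → Vec p) {m : ℕ} (hm : 0 < m) (j k : ℕ) :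
    contrastSN h m j k = quadForm
      (Matrix.of fun α β => ((m : ℝ) ^ 4)⁻¹ * blockMatrix h 0 (m + j) α β +
        ((m : ℝ) ^ 4)⁻¹ * blockMatrix h (m + j) (m + k) α β)⁻¹
      (scaledContrast h m 0 (m + j) (m + k)) := by
  have hm' : (0 : ℝ) < m := by exact_mod_cast hm
  have hσ2 : √(m : ℝ) ^ 2 = m := Real.sq_sqrt hm'.le
  have hV : (Matrix.of fun α β => ((m : ℝ) ^ 4)⁻¹ * blockMatrix h 0 (m + j) α β +
        ((m : ℝ) ^ 4)⁻¹ * blockMatrix h (m + j) (m + k) α β) =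
      ((m : ℝ) ^ 4)⁻¹ • (blockMatrix h 0 (m + j) + blockMatrix h (m + j) (m + k)) := by
    ext α β
    simp [mul_add]
  rw [hV, quadForm_inv_smul (by positivity), scaledContrast, quadForm_smul, quadForm_smul,
    contrastSN, inv_pow, mul_pow (m : ℝ), hσ2, inv_inv]
  push_cast
  field_simp
  ring

/-- Deterministic core of the limit theorem: estimators whose increments are uniformly close to
those of a nondegenerate continuous path have a maximal detector close to its limit. -/
theorem exists_abs_maxContrastSN_sub_lt {x : ℝ → Vec p} (hx : Continuous x) (hx0 : x 0 = 0)
    (hlin : ∀ (v : Fin p → ℝ) (c : ℝ),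
      (∀ t ∈ Icc (0 : ℝ) 1, ∑ α, v α * x t α = c * t) → v = 0)
    {T : ℝ} (hT : 0 < T) {w : ℝ → ℝ} (hw_mono : MonotoneOn w (Icc 0 T))
    (hw_pos : ∀ t ∈ Icc 0 T, 0 < w t) {ε : ℝ} (hε : 0 < ε) :
    ∃ δ > 0, ∃ m₀ : ℕ, ∀ m ≥ m₀, ∀ (h : ℕ → ℕ → Vec p) (c : Vec p),
      IsPathApprox h c x (T + 1) m δ → |maxContrastSN h T w m - limitSN T w x| < ε := by
  set K : Set (ℝ × ℝ) := {q | 1 ≤ q.1 ∧ q.1 ≤ q.2 ∧ q.2 ≤ T + 1} with hK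
  have hKc : IsCompact K := by
    refine (isCompact_Icc (a := ((1 : ℝ), (1 : ℝ))) (b := (T + 1, T + 1))).of_isClosed_subset ?_ ?_
    · exact (isClosed_le continuous_const continuous_fst).inter
        ((isClosed_le continuous_fst continuous_snd).inter
          (isClosed_le continuous_snd continuous_const))
    · rintro ⟨s, t⟩ ⟨h1, h2, h3⟩
      exact ⟨⟨h1, h1.trans h2⟩, ⟨h2.trans h3, h3⟩⟩
  have hφ : ∀ q ∈ K, ContinuousAt
      (fun q : (Fin p → Fin p → ℝ) × Vec p => quadForm (Matrix.of q.1)⁻¹ q.2) (limitPair x q) := by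
    intro q hq
    refine continuousAt_quadForm_inv ?_
    rw [of_limitPair_fst hx0]
    exact det_N1_add_N2_ne_zero hx hx0 hlin hq.1 hq.2.1
  have hg : ContinuousOn (fun q : ℝ × ℝ => bridgeSN x q.1 q.2) K := by
    intro q hq
    simp only [bridgeSN_eq hx0]
    exact ((hφ q hq).comp (continuous_limitPair hx).continuousAt).continuousWithinAt
  obtain ⟨ε₁, hε₁, m₁, hm₁⟩ := exists_abs_iSup_grid_sub_lt hT hw_mono hw_pos hg
    (fun s t hs hst _ => bridgeSN_nonneg hx hx0 hlin hs hst) (bridgeSN_self x) hε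
  -- The discrete pair need not lie in the compact image of the triangle, so uniformity is required
  -- with only one of the two points in that set.
  obtain ⟨η, hη, hclose⟩ := Metric.mem_uniformity_dist.1
    ((hKc.image (continuous_limitPair hx)).uniformContinuousAt_of_continuousAt
      (fun q : (Fin p → Fin p → ℝ) × Vec p => quadForm (Matrix.of q.1)⁻¹ q.2)
      (by rintro _ ⟨q, hq, rfl⟩; exact hφ q hq) (Metric.dist_mem_uniformity hε₁))
  obtain ⟨δ₂, hδ₂, m₂, hm₂⟩ := exists_abs_blockMatrix_sub_le hx (b := T + 1) (by linarith)
    (ε := η / 4) (by positivity)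
  refine ⟨min δ₂ (η / 2 / (T + 1)), lt_min hδ₂ (by positivity), max m₁ m₂, ?_⟩
  intro m hm h c hh
  have hδ0 : 0 < min δ₂ (η / 2 / (T + 1)) := lt_min hδ₂ (by positivity)
  obtain ⟨hmpos, hblock⟩ := hm₂ m ((le_max_right _ _).trans hm)
  have hm' : (0 : ℝ) < m := by exact_mod_cast hmpos
  have hh2 : IsPathApprox h c x (T + 1) m δ₂ := fun i j hij hj => (hh i j hij hj).trans
    (mul_le_mul_of_nonneg_left (min_le_left _ _) (Real.sqrt_nonneg _))
  refine hm₁ m ((le_max_left _ _).trans hm) (contrastSN h m) fun j k hjk hk => ?_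
  have hdiv : ∀ i : ℕ, ((m + i : ℕ) : ℝ) / m = 1 + (i : ℝ) / m := fun i => by
    push_cast; field_simp
  have hmk : ((m + k : ℕ) : ℝ) ≤ (T + 1) * m := by push_cast; linarith
  have hjkR : (j : ℝ) ≤ k := by exact_mod_cast hjk.le
  have hmj : ((m + j : ℕ) : ℝ) ≤ (T + 1) * m := by push_cast; linarith
  have hqK : (1 + (j : ℝ) / m, 1 + (k : ℝ) / m) ∈ K := by
    have h1 : 0 ≤ (j : ℝ) / m := by positivity
    have h2 : (k : ℝ) / m ≤ T := by rwa [div_le_iff₀ hm']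
    have h3 : (j : ℝ) / m ≤ (k : ℝ) / m := by gcongr
    exact ⟨by linarith, by linarith, by linarith⟩
  rw [contrastSN_eq h hmpos, bridgeSN_eq hx0 (1 + (j : ℝ) / m, 1 + (k : ℝ) / m), abs_sub_comm,
    ← Real.dist_eq]
  refine le_of_lt (hclose (a := limitPair x (1 + (j : ℝ) / m, 1 + (k : ℝ) / m))
    (b := (fun α β => ((m : ℝ) ^ 4)⁻¹ * blockMatrix h 0 (m + j) α β +
        ((m : ℝ) ^ 4)⁻¹ * blockMatrix h (m + j) (m + k) α β,
      scaledContrast h m 0 (m + j) (m + k))) ?_ ⟨_, hqK, rfl⟩)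
  refine lt_of_le_of_lt (b := η / 2) ?_ (by linarith)
  rw [Prod.dist_eq]
  refine max_le ?_ ?_
  · rw [dist_pi_le_iff (by positivity)]
    intro α
    rw [dist_pi_le_iff (by positivity)]
    intro β
    have h1 := hblock h c hh2 0 (m + j) (Nat.zero_le _) hmj α β
    have h2 := hblock h c hh2 (m + j) (m + k) (by omega) hmk α β
    rw [hdiv, Nat.cast_zero, zero_div] at h1
    rw [hdiv, hdiv] at h2
    rw [dist_comm, Real.dist_eq]
    simp only [limitPair]
    rw [add_sub_add_comm]
    refine (abs_add_le _ _).trans ?_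
    linarith
  · have h1 := hh.norm_scaledContrast_sub_le hmpos hδ0.le (a := 0) (j := m + j) (k := m + k)
      (by omega) (by omega) hmk
    rw [hdiv, hdiv, Nat.cast_zero, zero_div] at h1
    rw [dist_comm, dist_eq_norm]
    refine h1.trans ?_
    have h2 : min δ₂ (η / 2 / (T + 1)) ≤ η / 2 / (T + 1) := min_le_right _ _
    rw [le_div_iff₀ (by linarith)] at h2
    linarith

/-! ### Brownian paths -/

section Paths

variable {Ω' : Type*} [MeasurableSpace Ω'] {p : ℕ} {W : ℝ≥0 → Ω' → Vec p} {P : Measure Ω'}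

theorem IsStdBrownianMotion.ae_continuous_path (hW : IsStdBrownianMotion W P) :
    ∀ᵐ ω ∂P, Continuous (path W ω) := by
  filter_upwards [ae_all_iff.2 fun a => (hW.coord a).cont] with ω hω
  have h : Continuous fun s : ℝ => (WithLp.toLp 2 fun a => W s.toNNReal ω a : Vec p) :=
    (PiLp.continuous_toLp 2 _).comp
      (continuous_pi fun a => (hω a).comp continuous_real_toNNReal)
  exact h

theorem IsStdBrownianMotion.ae_path_zero (hW : IsStdBrownianMotion W P) :
    ∀ᵐ ω ∂P, path W ω 0 = 0 := by
  filter_upwards [ae_all_iff.2 fun a =>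
    (hW.coord a).toIsPreBrownianReal.eval_zero_ae_eq_zero] with ω hω
  ext a
  simpa [path] using hω a

theorem IsStdBrownianMotion.ae_path_linear_eq_zero [IsProbabilityMeasure P]
    (hW : IsStdBrownianMotion W P) :
    ∀ᵐ ω ∂P, ∀ (v : Fin p → ℝ) (c : ℝ),
      (∀ t ∈ Icc (0 : ℝ) 1, ∑ α, v α * path W ω t α = c * t) → v = 0 := by
  filter_upwards [hW.ae_forall_linear_eq_zero] with ω hω v c h
  refine hω v c fun t ht => ?_
  simpa [path] using h t ⟨t.2, by exact_mod_cast ht⟩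

/-- The supremum is uncountable, so measurability comes from an almost sure limit of finite maxima:
the deterministic theorem is applied to artificial estimators that reproduce the increments of W
exactly. -/
theorem aemeasurable_limitSN_path [IsProbabilityMeasure P] (hW : IsStdBrownianMotion W P)
    {T : ℝ} (hT : 0 < T) {w : ℝ → ℝ} (hw_mono : MonotoneOn w (Icc 0 T))
    (hw_pos : ∀ t ∈ Icc 0 T, 0 < w t) :
    AEMeasurable (fun ω => limitSN T w (path W ω)) P := by
  let h : ℕ → Ω' → ℕ → ℕ → Vec p := fun m ω i j =>
    (√(m : ℝ) / ((j : ℝ) - ((i : ℝ) - 1))) •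
      (path W ω ((j : ℝ) / m) - path W ω (((i : ℝ) - 1) / m))
  refine aemeasurable_of_tendsto_metrizable_ae' (f := fun m ω => maxContrastSN (h m ω) T w m)
    (fun m => aemeasurable_maxContrastSN (h := fun i j ω => h m ω i j) (fun i j _ => ?_) T w m) ?_
  · exact (((hW.measurable _).sub (hW.measurable _)).const_smul
      (√(m : ℝ) / ((j : ℝ) - ((i : ℝ) - 1)))).aemeasurable
  · filter_upwards [hW.ae_continuous_path, hW.ae_path_zero, hW.ae_path_linear_eq_zero]
      with ω hx hx0 hlin
    refine Metric.tendsto_atTop.2 fun ε hε => ?_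
    obtain ⟨δ, hδ, m₀, hm₀⟩ :=
      exists_abs_maxContrastSN_sub_lt hx hx0 hlin hT hw_mono hw_pos hε
    refine ⟨m₀, fun m hm => ?_⟩
    rw [Real.dist_eq]
    refine hm₀ m hm (h m ω) 0 fun i j hij _ => ?_
    have hij' : (j : ℝ) - i ≠ 0 := sub_ne_zero.2 (by exact_mod_cast hij.ne')
    have hz : ((j : ℝ) - i) • (h m ω (i + 1) j - 0) -
        √(m : ℝ) • (path W ω ((j : ℝ) / m) - path W ω ((i : ℝ) / m)) = 0 := by
      simp only [h, Nat.cast_add, Nat.cast_one, add_sub_cancel_right, sub_zero]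
      rw [smul_smul, mul_div_cancel₀ _ hij', sub_self]
    rw [hz, norm_zero]
    positivity

end Paths

/-! ### Estimators along partial sum processes -/

section Estimators

variable {Ω : Type*} {d p : ℕ}

theorem norm_sub_mul_remainder_le (θ : (Vec d → ℝ) → Vec p) (F : Vec d → ℝ)
    (IF : Vec d → Vec p) (X : ℤ → Ω → Vec d) (ω : Ω) {n i j : ℕ} (hij : i < j) (hj : j ≤ n) :
    ‖((j : ℝ) - i) • remainder θ F IF X (i + 1) j ω‖ ≤ maxRemainder θ F IF X n ω := by
  have hfin : Finite {q : ℕ × ℕ // 1 ≤ q.1 ∧ q.1 ≤ q.2 ∧ q.2 ≤ n} := by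
    refine Set.Finite.to_subtype (s := {q : ℕ × ℕ | 1 ≤ q.1 ∧ q.1 ≤ q.2 ∧ q.2 ≤ n}) ?_
    refine (Set.finite_Iic (n, n)).subset fun q hq => ?_
    exact ⟨hq.2.1.trans hq.2.2, hq.2.2⟩
  have hij' : (i : ℝ) < j := by exact_mod_cast hij
  refine le_ciSup_of_le (Set.finite_range _).bddAbove ⟨(i + 1, j), by omega, hij, hj⟩ ?_
  rw [norm_smul, Real.norm_of_nonneg (by linarith)]
  refine mul_le_mul_of_nonneg_right ?_ (norm_nonneg _)
  push_cast
  linarith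

/-- At grid times k/m the floor in the partial sum process is exactly k, so block sums of influence
functions are increments of that process. -/
theorem sub_smul_thetaHat_sub (θ : (Vec d → ℝ) → Vec p) (F : Vec d → ℝ)
    (IF : Vec d → Vec p) (X : ℤ → Ω → Vec d) (ω : Ω) {b : ℝ} {m i j : ℕ} (hm : 0 < m)
    (hij : i < j) (hi : (i : ℝ) / m ∈ Icc 0 b) (hj : (j : ℝ) / m ∈ Icc 0 b) :
    ((j : ℝ) - i) • (thetaHat θ X (i + 1) j ω - θ F) =
      √(m : ℝ) • (partialSum IF X b m ω ⟨(j : ℝ) / m, hj⟩ -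
        partialSum IF X b m ω ⟨(i : ℝ) / m, hi⟩) +
      ((j : ℝ) - i) • remainder θ F IF X (i + 1) j ω := by
  have hm' : (0 : ℝ) < m := by exact_mod_cast hm
  have hσ : √(m : ℝ) ≠ 0 := (Real.sqrt_pos.2 hm').ne'
  have hij' : (j : ℝ) - i ≠ 0 := sub_ne_zero.2 (by exact_mod_cast hij.ne')
  have hfl : ∀ k : ℕ, ⌊(m : ℝ) * ((k : ℝ) / m)⌋₊ = k := fun k => by
    rw [mul_div_cancel₀ _ hm'.ne', Nat.floor_natCast]
  have hsum : ∑ t ∈ Finset.Icc (i + 1) j, IF (X t ω) =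
      ∑ t ∈ Finset.Icc 1 j, IF (X t ω) - ∑ t ∈ Finset.Icc 1 i, IF (X t ω) := by
    have hIcc : ∀ a b : ℕ, Finset.Icc (a + 1) b = Finset.Ioc a b := fun a b => by
      ext
      simp
    rw [eq_sub_iff_add_eq, add_comm, ← zero_add 1, hIcc, hIcc, hIcc]
    exact Finset.sum_Ioc_consecutive (fun t : ℕ => IF (X t ω)) (Nat.zero_le i) hij.le
  have hc : ((j : ℝ) - ((i + 1 : ℕ) : ℝ) + 1) = (j : ℝ) - i := by push_cast; ring
  rw [remainder, hc, hsum]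
  simp only [partialSum, hfl]
  generalize ∑ t ∈ Finset.Icc 1 j, IF (X t ω) = a
  generalize ∑ t ∈ Finset.Icc 1 i, IF (X t ω) = a'
  generalize √(m : ℝ) = σ at hσ
  generalize (j : ℝ) - i = l at hij'
  match_scalars <;> field_simp <;> ring

theorem isUnit_det_sqrt {S : Matrix (Fin p) (Fin p) ℝ} (hS : S.PosDef) :
    IsUnit (CFC.sqrt S).det := by
  rw [isUnit_iff_ne_zero]
  intro h0
  have h := congrArg Matrix.det (CFC.sqrt_mul_sqrt_self S hS.posSemidef.nonneg)
  rw [Matrix.det_mul, h0, zero_mul] at h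
  exact hS.det_pos.ne h

/-- If the partial sum process is close to `A x` and the remainders are small, then the estimators
transformed by `A⁻¹` are close to the path `x`. -/
theorem isPathApprox_inv_mulVec {A : Matrix (Fin p) (Fin p) ℝ} (hA : IsUnit A.det)
    {x : ℝ → Vec p} {T : ℝ} {m : ℕ} (hm : 0 < m)
    (θ : (Vec d → ℝ) → Vec p) (F : Vec d → ℝ) (IF : Vec d → Vec p) (X : ℤ → Ω → Vec d) (ω : Ω)
    {δ : ℝ}
    (hY : ∀ s : Icc (0 : ℝ) (T + 1),
      ‖partialSum IF X (T + 1) m ω s - WithLp.toLp 2 (A *ᵥ (x s).ofLp)‖ ≤ δ)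
    (hr : maxRemainder θ F IF X ⌊(T + 1) * (m : ℝ)⌋₊ ω ≤ √(m : ℝ) * δ) :
    IsPathApprox (fun i j => WithLp.toLp 2 (A⁻¹ *ᵥ (thetaHat θ X i j ω).ofLp))
      (WithLp.toLp 2 (A⁻¹ *ᵥ (θ F).ofLp)) x (T + 1) m
      (‖(Matrix.toEuclideanLin A⁻¹).toContinuousLinearMap‖ * (3 * δ)) := by
  intro i j hij hj
  have hm' : (0 : ℝ) < m := by exact_mod_cast hm
  have hij' : (i : ℝ) < j := by exact_mod_cast hij
  have hI : ∀ k : ℕ, (k : ℝ) ≤ j → (k : ℝ) / m ∈ Icc 0 (T + 1) := fun k hk =>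
    ⟨by positivity, by rw [div_le_iff₀ hm']; linarith⟩
  let L : Vec p →L[ℝ] Vec p := (Matrix.toEuclideanLin A⁻¹).toContinuousLinearMap
  have hL : ∀ v : Vec p, L v = WithLp.toLp 2 (A⁻¹ *ᵥ v.ofLp) := fun v => rfl
  have hLA : ∀ v : Vec p, L (WithLp.toLp 2 (A *ᵥ v.ofLp)) = v := fun v => by
    rw [hL, Matrix.mulVec_mulVec, Matrix.nonsing_inv_mul _ hA, Matrix.one_mulVec]
  set xj := x ((j : ℝ) / m)
  set xi := x ((i : ℝ) / m)
  -- Three errors, one for each endpoint of the increment and one for the remainder, account for the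
  -- factor 3.
  have hkey : ((j : ℝ) - i) • (L (thetaHat θ X (i + 1) j ω) - L (θ F)) - √(m : ℝ) • (xj - xi) =
      L (√(m : ℝ) • (partialSum IF X (T + 1) m ω ⟨(j : ℝ) / m, hI j le_rfl⟩ -
          WithLp.toLp 2 (A *ᵥ xj.ofLp)) -
        √(m : ℝ) • (partialSum IF X (T + 1) m ω ⟨(i : ℝ) / m, hI i hij'.le⟩ -
          WithLp.toLp 2 (A *ᵥ xi.ofLp)) +
        ((j : ℝ) - i) • remainder θ F IF X (i + 1) j ω) := by
    rw [← map_sub, ← map_smul, sub_smul_thetaHat_sub θ F IF X ω hm hij (hI i hij'.le)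
      (hI j le_rfl)]
    simp only [map_add, map_sub, map_smul, hLA]
    module
  simp only [← hL]
  rw [hkey]
  refine (L.le_opNorm _).trans ?_
  rw [mul_left_comm]
  refine mul_le_mul_of_nonneg_left ?_ (norm_nonneg _)
  refine (norm_add_le _ _).trans ?_
  have h1 := (norm_sub_mul_remainder_le θ F IF X ω hij (Nat.le_floor hj)).trans hr
  have h2 : ∀ s : Icc (0 : ℝ) (T + 1), ‖√(m : ℝ) • (partialSum IF X (T + 1) m ω s -
      WithLp.toLp 2 (A *ᵥ (x s).ofLp))‖ ≤ √(m : ℝ) * δ := fun s => by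
    rw [norm_smul, Real.norm_of_nonneg (Real.sqrt_nonneg _)]
    exact mul_le_mul_of_nonneg_left (hY s) (Real.sqrt_nonneg _)
  have h3 := (norm_sub_le _ _).trans (add_le_add (h2 ⟨(j : ℝ) / m, hI j le_rfl⟩)
    (h2 ⟨(i : ℝ) / m, hI i hij'.le⟩))
  linarith

/-- The sample has size n = ⌊b m⌋, and √n ≤ √b √m lets the threshold ε be traded for ε / √b. -/
theorem tendstoInMeasure_maxRemainder [MeasurableSpace Ω] {μ : Measure Ω}
    {θ : (Vec d → ℝ) → Vec p} {F : Vec d → ℝ} {IF : Vec d → Vec p} {X : ℤ → Ω → Vec d}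
    (h : RemainderAssumption μ θ F IF X) {b : ℝ} (hb : 0 < b) :
    TendstoInMeasure μ (fun (m : ℕ) ω => maxRemainder θ F IF X ⌊b * (m : ℝ)⌋₊ ω / √(m : ℝ))
      atTop (fun _ => 0) := by
  rw [tendstoInMeasure_iff_norm]
  intro ε hε
  have hn : Tendsto (fun m : ℕ => ⌊b * (m : ℝ)⌋₊) atTop atTop :=
    tendsto_nat_floor_atTop.comp (tendsto_natCast_atTop_atTop.const_mul_atTop hb)
  have h0 := ((tendstoInMeasure_iff_norm.1 h) (ε / √b) (by positivity)).comp hn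
  refine tendsto_of_tendsto_of_tendsto_of_le_of_le' tendsto_const_nhds h0
    (Eventually.of_forall fun _ => zero_le) ?_
  filter_upwards [hn.eventually_ge_atTop 1, eventually_ge_atTop 1] with m hm hm1
  refine measure_mono fun ω hω => ?_
  simp only [mem_ofPred_eq, sub_zero, norm_div, Real.norm_of_nonneg (Real.sqrt_nonneg _)] at hω ⊢
  have hm' : (0 : ℝ) < m := by exact_mod_cast hm1
  have hn' : (0 : ℝ) < ⌊b * (m : ℝ)⌋₊ := by exact_mod_cast hm
  have hle : √(⌊b * (m : ℝ)⌋₊ : ℝ) ≤ √b * √(m : ℝ) := by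
    rw [← Real.sqrt_mul hb.le]
    exact Real.sqrt_le_sqrt (Nat.floor_le (by positivity))
  rw [le_div_iff₀ (by positivity)] at hω
  rw [le_div_iff₀ (by positivity)]
  refine le_trans ?_ hω
  calc ε / √b * √(⌊b * (m : ℝ)⌋₊ : ℝ) ≤ ε / √b * (√b * √(m : ℝ)) := by gcongr
    _ = ε * √(m : ℝ) := by field_simp

end Estimators

/-- Continuity on a compact interval gives boundedness, so the default value 0 is not taken. -/
theorem toEllInfty_apply_of_continuous {E : Type} [NormedAddCommGroup E] {b : ℝ} {f : ℝ → E}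
    (hf : Continuous f) (s : Icc (0 : ℝ) b) :
    (toEllInfty fun s : Icc (0 : ℝ) b => f s : Icc (0 : ℝ) b → E) s = f s := by
  have h : Memℓp (E := fun _ : Icc (0 : ℝ) b => E) (fun s => f s) ∞ := by
    obtain ⟨C, hC⟩ := isCompact_Icc.exists_bound_of_continuousOn (hf.continuousOn (s := Icc 0 b))
    refine memℓp_infty ⟨C, ?_⟩
    rintro _ ⟨u, rfl⟩
    exact hC u u.2
  simp [toEllInfty, h]

end SeqMonitor

/-! ### The limit theorem for the self-normalized detector -/

theorem mainTheorem3 {Ω Ω' : Type*} [MeasurableSpace Ω] [MeasurableSpace Ω']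
    (μ : Measure Ω) [IsProbabilityMeasure μ] (P : Measure Ω') [IsProbabilityMeasure P]
    (d p : ℕ) (T : ℝ) (hT : 0 < T)
    (X : ℤ → Ω → SeqMonitor.Vec d) (hX : ∀ t, Measurable (X t))
    (θ : (SeqMonitor.Vec d → ℝ) → SeqMonitor.Vec p)
    (hθ : ∀ i j : ℕ, 1 ≤ i → i ≤ j → AEMeasurable (SeqMonitor.thetaHat θ X i j) μ)
    (F : SeqMonitor.Vec d → ℝ) (hF : F = SeqMonitor.distFun μ (X 1))
    (IF : SeqMonitor.Vec d → SeqMonitor.Vec p) (hIF : SeqMonitor.IsInfluenceFunction θ F IF)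
    (S : Matrix (Fin p) (Fin p) ℝ) (hS : S.PosDef)
    (W : ℝ≥0 → Ω' → SeqMonitor.Vec p) (hW : SeqMonitor.IsStdBrownianMotion W P)
    (hH0 : ∀ t : ℕ, 1 ≤ t →
      θ (SeqMonitor.distFun μ (X t)) = θ (SeqMonitor.distFun μ (X 1)))
    (h1 : SeqMonitor.InvarianceAssumption μ P T X IF S W)
    (h2 : SeqMonitor.RemainderAssumption μ θ F IF X)
    (w : ℝ → ℝ) (hw_mono : MonotoneOn w (Icc 0 T)) (hw_pos : ∀ t ∈ Icc 0 T, 0 < w t) :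
    TendstoInDistribution
      (fun (m : ℕ) ω => SeqMonitor.maxDetectorSN θ X T w m ω) atTop
      (fun ω => SeqMonitor.limitSN T w (SeqMonitor.path W ω))
      (fun _ => μ) P := by

  have hlim := SeqMonitor.aemeasurable_limitSN_path hW hT hw_mono hw_pos
  have hA := SeqMonitor.isUnit_det_sqrt hS
  have hA' : IsUnit (CFC.sqrt S)⁻¹.det := Matrix.isUnit_nonsing_inv_det _ hA
  -- The detector uses observations up to m + k ≤ (T + 1) m, hence b = T + 1.
  refine SeqMonitor.tendstoInDistribution_of_forall_dist_lt h1.fclt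
    (SeqMonitor.tendstoInMeasure_maxRemainder h2 (b := T + 1) (by linarith)) ?_ hlim ?_
  · intro m
    simp only [SeqMonitor.maxDetectorSN_eq]
    refine SeqMonitor.aemeasurable_maxContrastSN
      (h := fun i j ω => SeqMonitor.thetaHat θ X i j ω) (fun i j hi => ?_) T w m
    by_cases hij : i ≤ j
    · exact hθ i j hi hij
    · simp only [SeqMonitor.thetaHat, if_neg hij]
      exact aemeasurable_const
  filter_upwards [hW.ae_continuous_path, hW.ae_path_zero, hW.ae_path_linear_eq_zero]
    with ω' hx hx0 hlin ε hε
  obtain ⟨δ, hδ, m₀, hm₀⟩ :=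
    SeqMonitor.exists_abs_maxContrastSN_sub_lt hx hx0 hlin hT hw_mono hw_pos hε
  set C := ‖(Matrix.toEuclideanLin (CFC.sqrt S)⁻¹).toContinuousLinearMap‖ with hC
  have hC0 : 0 ≤ C := norm_nonneg _
  -- Inverting the square root of S amplifies errors by at most C; C + 1 keeps the denominator
  -- positive.
  set δ' := δ / (3 * (C + 1)) with hδ'
  have hδ'0 : 0 < δ' := by positivity
  have hδ'le : C * (3 * δ') ≤ δ := by
    have h : δ' * (3 * (C + 1)) = δ := div_mul_cancel₀ _ (by positivity)
    nlinarith
  refine ⟨δ', hδ'0, max m₀ 1, fun m hm ω hY hr => ?_⟩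
  have hm1 : 0 < m := (le_max_right m₀ 1).trans hm
  have hσ : 0 < √(m : ℝ) := Real.sqrt_pos.2 (by exact_mod_cast hm1)
  have hcont : Continuous fun s : ℝ =>
      (WithLp.toLp 2 (CFC.sqrt S *ᵥ (SeqMonitor.path W ω' s).ofLp) : SeqMonitor.Vec p) :=
    (Matrix.toEuclideanLin (CFC.sqrt S)).toContinuousLinearMap.continuous.comp hx
  have happ := SeqMonitor.isPathApprox_inv_mulVec hA (x := SeqMonitor.path W ω') hm1 θ F IF X ω
    (δ := δ') (fun s => by
      rw [dist_eq_norm] at hY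
      have h := (lp.norm_apply_le_norm ENNReal.top_ne_zero _ s).trans hY.le
      rwa [lp.coeFn_sub, Pi.sub_apply, SeqMonitor.toEllInfty_partialSum,
        SeqMonitor.toEllInfty_apply_of_continuous hcont] at h)
    (by
      rw [Real.norm_eq_abs] at hr
      have h := (le_abs_self _).trans hr.le
      rw [div_le_iff₀ hσ] at h
      linarith)
  -- The detector is unchanged by standardizing the estimators, and the standardized ones follow the
  -- Brownian path itself.
  rw [SeqMonitor.maxDetectorSN_eq, ← SeqMonitor.maxContrastSN_mulVec hA']
  exact hm₀ m ((le_max_left _ _).trans hm) _ _ fun i j hij hj => (happ i j hij hj).trans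
    (mul_le_mul_of_nonneg_left hδ'le hσ.le)
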